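/- Let $k$ be any field, let $n \geq 0$, and let $K_n$ be the complete graph on the vertices $x_1,\dots,x_n$. Let $R = k[x_1,\dots,x_n]$, let $I(K_n) = \langle x_a x_b \mid 1 \leq a < b \leq n\rangle \subseteq R$ be its graph ideal, and regard $k$ as the $R$-module $R/\langle x_1,\dots,x_n\rangle$. The $R$-modules $\mathrm{Tor}_i^R(R/I(K_n),k)$ are $\mathbb{N}^n$-graded, since $I(K_n)$ is a monomial ideal. For $i, d \in \mathbb{N}$ define the $\mathbb{N}$-graded Betti numbers $$\beta_{i,d}(K_n) = \sum_{\mathbf{a}\in\mathbb{N}^n,\ a_1+\dots+a_n=d} \dim_k \bigl(\mathrm{Tor}_i^R(R/I(K_n),k)\bigr)_{\mathbf{a}}$$ and the total Betti numbers $\beta_i(K_n) = \dim_k \mathrm{Tor}_i^R(R/I(K_n),k)$. Then for all $i \geq 1$ and all $d \geq 0$ $$\beta_{i,d}(K_n) = \begin{cases} i\binom{n}{i+1} & \text{if } d = i+1,\\ 0 & \text{if } d \neq i+1,\end{cases} \qquad \beta_i(K_n) = i\binom{n}{i+1},$$ while $\beta_{0,0}(K_n) = 1$, $\beta_{0,d}(K_n)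 = 0$ for $d \neq 0$, and $\beta_0(K_n) = 1$. In particular these numbers do not depend on the field $k$. -/

import Mathlib

open CategoryTheory
open scoped TensorProduct

noncomputable section

namespace GraphBetti

universe u v

/-- The graph ideal `I(G)` of `k[x_v : v ∈ V]`, generated by the products `x_u x_v` over the
edges `{u, v}` of `G`. -/
def edgeIdeal (k : Type u) [Field k] {V : Type v} (G : SimpleGraph V) :
    Ideal (MvPolynomial V k) :=
  Ideal.span {p | ∃ u v : V, G.Adj u v ∧ p = MvPolynomial.X u * MvPolynomial.X v}

/-- The ideal generated by all variables; `k` is the module `k[x] / irrelevantIdeal`. -/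
def irrelevantIdeal (k : Type u) [Field k] (V : Type v) : Ideal (MvPolynomial V k) :=
  Ideal.span (Set.range MvPolynomial.X)

/-- The part of multidegree `a` of the graded free module `⨁ b, R(-deg b)`, with `R = k[x]`:
the coordinate at `b` is a scalar multiple of the monomial `x ^ (a - deg b)`, and is zero
if `deg b ≤ a` fails. -/
def freeComponent (k : Type u) [Field k] {V : Type v} {ι : Type} (deg : ι → V →₀ ℕ)
    (a : V →₀ ℕ) : Submodule k (ι → MvPolynomial V k) :=
  Submodule.pi Set.univ fun b => MvPolynomial.restrictSupport k {m | m + deg b = a}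

/-- A multigraded free resolution `⋯ → F₁ → F₀ → R/I → 0`, `R = k[x]`, by finitely generated
graded free modules `F i = ⨁ b, R(-deg i b)` and homogeneous maps of degree `0`. -/
structure MultigradedFreeResolution {k : Type u} [Field k] {V : Type v}
    (I : Ideal (MvPolynomial V k)) where
  /-- the rank of `F i` -/
  rank : ℕ → ℕ
  /-- the multidegrees of the basis vectors of `F i` -/
  deg : ∀ i, Fin (rank i) → V →₀ ℕ
  /-- the augmentation `F 0 → R/I` -/
  aug : (Fin (rank 0) → MvPolynomial V k) →ₗ[MvPolynomial V k] (MvPolynomial V k ⧸ I)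
  /-- the differentials `F (i+1) → F i` -/
  d : ∀ i, (Fin (rank (i + 1)) → MvPolynomial V k) →ₗ[MvPolynomial V k]
    (Fin (rank i) → MvPolynomial V k)
  aug_homogeneous : ∀ b, ∃ p ∈ MvPolynomial.restrictSupport k {deg 0 b},
    aug (Pi.single b 1) = Ideal.Quotient.mk I p
  d_homogeneous : ∀ i c, d i (Pi.single c 1) ∈ freeComponent k (deg i) (deg (i + 1) c)
  aug_surjective : Function.Surjective aug
  exact_zero : Function.Exact (d 0) aug
  exact_succ : ∀ i, Function.Exact (d (i + 1)) (d i)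

namespace MultigradedFreeResolution

variable {k : Type u} [Field k] {V : Type v} {I : Ideal (MvPolynomial V k)}

/-- The module `F i ⊗ k` of the complex `F ⊗ k`. -/
abbrev Tensored (F : MultigradedFreeResolution I) (i : ℕ) : Type (max u v) :=
  (Fin (F.rank i) → MvPolynomial V k) ⊗[MvPolynomial V k]
    (MvPolynomial V k ⧸ irrelevantIdeal k V)

/-- The differential `F (i+1) ⊗ k → F i ⊗ k`. -/
def tensoredD (F : MultigradedFreeResolution I) (i : ℕ) :
    F.Tensored (i + 1) →ₗ[MvPolynomial V k] F.Tensored i :=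
  (F.d i).rTensor (MvPolynomial V k ⧸ irrelevantIdeal k V)

/-- The cycles of `F ⊗ k`. -/
def cycles (F : MultigradedFreeResolution I) :
    ∀ i, Submodule (MvPolynomial V k) (F.Tensored i)
  | 0 => ⊤
  | i + 1 => LinearMap.ker (F.tensoredD i)

/-- The part of multidegree `a` of `F i ⊗ k`: the elements `f ⊗ 1` with `f` of degree `a`. -/
def tensoredComponent (F : MultigradedFreeResolution I) (i : ℕ) (a : V →₀ ℕ) :
    Submodule k (F.Tensored i) :=
  (freeComponent k (F.deg i) a).map
    (((TensorProduct.mk (MvPolynomial V k) (Fin (F.rank i) → MvPolynomial V k)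
      (MvPolynomial V k ⧸ irrelevantIdeal k V)).flip 1).restrictScalars k)

/-- The part of multidegree `a` of `Tor i (R/I, k)`: the classes of the cycles of multidegree
`a` in `F i ⊗ k` modulo boundaries. The module `Tor i (R/I, k)` itself is the image of all
cycles in this quotient. -/
def torComponent (F : MultigradedFreeResolution I) (i : ℕ) (a : V →₀ ℕ) :
    Submodule k (F.Tensored i ⧸ LinearMap.range (F.tensoredD i)) :=
  (F.tensoredComponent i a ⊓ (F.cycles i).restrictScalars k).map
    ((LinearMap.range (F.tensoredD i)).mkQ.restrictScalars k)

end MultigradedFreeResolution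

open Classical in
/-- `β_{i,a}(R/I) = dim_k (Tor i (R/I, k))_a` for a monomial ideal `I`. The graded vector space
`Tor i (R/I, k)` does not depend on the multigraded free resolution that computes it. If there
is no such resolution (for finite `V`: if `I` is not monomial), the value is `0`. -/
def multigradedBetti {k : Type u} [Field k] {V : Type v} (I : Ideal (MvPolynomial V k))
    (i : ℕ) (a : V →₀ ℕ) : ℕ :=
  if h : Nonempty (MultigradedFreeResolution I) then
    Module.finrank k (h.some.torComponent i a)
  else 0

/-- `β_{i,d}(G)`: the sum of the `β_{i,a}(k[x]/I(G))` over the multidegrees `a` with `|a| = d`. -/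
def gradedBetti (k : Type u) [Field k] {V : Type v} [Fintype V] [DecidableEq V]
    (G : SimpleGraph V) (i d : ℕ) : ℕ :=
  ∑ a ∈ Finset.finsuppAntidiag (Finset.univ : Finset V) d, multigradedBetti (edgeIdeal k G) i a

/-- `β_i(G) = dim_k Tor i (k[x]/I(G), k)`, the total Betti number. Here `Tor'` is `Tor`
computed by resolving its first argument; the `k[x]`-module is viewed as a `k`-space. -/
def totalBetti (k : Type u) [Field k] {V : Type v} (G : SimpleGraph V) (i : ℕ) : ℕ :=
  Module.finrank k
    ((ModuleCat.restrictScalars (algebraMap k (MvPolynomial V k))).obj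
      (((Tor' (ModuleCat.{max u v} (MvPolynomial V k)) i).obj
        (ModuleCat.of (MvPolynomial V k) (MvPolynomial V k ⧸ edgeIdeal k G))).obj
        (ModuleCat.of (MvPolynomial V k) (MvPolynomial V k ⧸ irrelevantIdeal k V))))

end GraphBetti

end

/-! The proof builds an explicit minimal multigraded free resolution of `R/I(K_n)` and counts its
basis. For each `a`, the Koszul complex of the variables other than `x_a` has as basis the sets `T`
containing `a`, placed in position `card T`. Take the direct sum over `a` and divide by the diagonal
copy of the full Koszul complex with its `∅` term removed. Position `p` of the quotient is the sum
over `card T = p` of `R^T / R(1,…,1)`; its basis consists of the pairs `(T, a)` with `a ∈ T` not the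
maximum of `T`, so `p - 1` for each `T`.

Koszul complexes are exact in positive degrees. Hence the long exact sequence leaves homology only
in position 2, and the connecting map identifies it with the kernel of `𝔪 → ⨁ R/(x_b : b ≠ a)`, `∑
x_a β_a ↦ (β_a)`, which is `I(K_n)`. Position `i + 1` therefore serves as homological degree `i ≥
1`, and the connecting map, `pointedSetD₀`, is the differential into `R`. The lemmas are
`koszul_exact`, `pointedSetD_exact`, `pointedSetD₀_exact` and `range_pointedSetD₀`.

All matrix entries lie in the ideal of the variables, so the differentials vanish after tensoring
with `k`, and Betti numbers count basis elements: `i * n.choose (i + 1)` of them in degree `i`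
(`card_pointedSet`), all of total degree `i + 1`. Since `multigradedBetti` uses an arbitrary
resolution, `finrank_torComponent_le` supplies independence of that choice. -/

noncomputable section

namespace GraphBetti

universe u v

/-! ### Multigraded resolutions as projective resolutions; comparison maps and `Tor'`. -/

namespace MultigradedFreeResolution

variable {k : Type u} [Field k] {V : Type v} {I : Ideal (MvPolynomial V k)}

/-- The underlying chain complex of a multigraded free resolution. -/
def complex (F : MultigradedFreeResolution I) :
    ChainComplex (ModuleCat.{max u v} (MvPolynomial V k)) ℕ :=
  ChainComplex.of (fun i => ModuleCat.of _ (Fin (F.rank i) → MvPolynomial V k))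
    (fun i => ModuleCat.ofHom (F.d i))
    (fun i => by
      ext1
      exact (F.exact_succ i).linearMap_comp_eq_zero)

lemma complex_d (F : MultigradedFreeResolution I) (i : ℕ) :
    F.complex.d (i + 1) i = ModuleCat.ofHom (F.d i) :=
  ChainComplex.of_d (fun i => ModuleCat.of _ (Fin (F.rank i) → MvPolynomial V k))
    (fun i => ModuleCat.ofHom (F.d i)) i

/-- The augmentation as a morphism of modules. -/
def augHom (F : MultigradedFreeResolution I) :
    F.complex.X 0 ⟶ ModuleCat.of.{max u v} (MvPolynomial V k) (MvPolynomial V k ⧸ I) :=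
  ModuleCat.ofHom F.aug

lemma complex_d_comp_aug (F : MultigradedFreeResolution I) :
    F.complex.d 1 0 ≫ F.augHom = 0 := by
  rw [complex_d]
  ext1
  exact F.exact_zero.linearMap_comp_eq_zero

lemma complex_exactAt_succ (F : MultigradedFreeResolution I) (i : ℕ) :
    F.complex.ExactAt (i + 1) := by
  rw [HomologicalComplex.exactAt_iff' _ (i + 1 + 1) (i + 1) i (by simp) (by simp)]
  refine ModuleCat.shortComplex_exact _ ?_
  simp only [HomologicalComplex.sc', HomologicalComplex.shortComplexFunctor'_obj_f,
    HomologicalComplex.shortComplexFunctor'_obj_g, complex_d]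
  exact F.exact_succ i

/-- A multigraded free resolution as a projective resolution. -/
def projectiveResolution (F : MultigradedFreeResolution I) :
    ProjectiveResolution (ModuleCat.of.{max u v} (MvPolynomial V k) (MvPolynomial V k ⧸ I)) where
  complex := F.complex
  projective n := ModuleCat.projective_of_free (Pi.basisFun (MvPolynomial V k) (Fin (F.rank n)))
  π := (ChainComplex.toSingle₀Equiv _ _).symm ⟨F.augHom, F.complex_d_comp_aug⟩
  quasiIso := ⟨fun n => by
    cases n with
    | zero =>
      rw [ChainComplex.quasiIsoAt₀_iff, ShortComplex.quasiIso_iff_of_zeros']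
      · constructor
        · refine ModuleCat.shortComplex_exact _ ?_
          simp only [complex_d, HomologicalComplex.shortComplexFunctor']
          exact F.exact_zero
        · simp only [HomologicalComplex.shortComplexFunctor']
          rw [ChainComplex.toSingle₀Equiv_symm_apply_f_zero]
          exact (ModuleCat.epi_iff_surjective _).2 F.aug_surjective
      all_goals rfl
    | succ n =>
      rw [quasiIsoAt_iff_exactAt']
      · exact F.complex_exactAt_succ n
      · apply ChainComplex.exactAt_succ_single_obj⟩

lemma projectiveResolution_π_f_zero (F : MultigradedFreeResolution I) :
    F.projectiveResolution.π.f 0 = F.augHom :=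
  ChainComplex.toSingle₀Equiv_symm_apply_f_zero _ _

/-- A family of linear maps commuting with the differentials, as a morphism of complexes. -/
def complexHom {F G : MultigradedFreeResolution I}
    (f : ∀ i, (Fin (F.rank i) → MvPolynomial V k) →ₗ[MvPolynomial V k]
      (Fin (G.rank i) → MvPolynomial V k))
    (hf : ∀ i, G.d i ∘ₗ f (i + 1) = f i ∘ₗ F.d i) : F.complex ⟶ G.complex where
  f i := ModuleCat.ofHom (f i)
  comm' := by
    rintro _ i rfl
    rw [complex_d, complex_d]
    ext1
    exact hf i

lemma exists_lift (F G : MultigradedFreeResolution I) :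
    ∃ f : ∀ i, (Fin (F.rank i) → MvPolynomial V k) →ₗ[MvPolynomial V k]
        (Fin (G.rank i) → MvPolynomial V k),
      G.aug ∘ₗ f 0 = F.aug ∧ ∀ i, G.d i ∘ₗ f (i + 1) = f i ∘ₗ F.d i := by
  let φ : F.complex ⟶ G.complex :=
    ProjectiveResolution.lift (𝟙 _) F.projectiveResolution G.projectiveResolution
  refine ⟨fun i => (φ.f i).hom, ?_, fun i => ?_⟩
  · have h : φ.f 0 ≫ _ = _ := ProjectiveResolution.lift_commutes_zero (𝟙 _)
      F.projectiveResolution G.projectiveResolution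
    rw [projectiveResolution_π_f_zero, projectiveResolution_π_f_zero] at h
    erw [Category.comp_id] at h
    exact congrArg ModuleCat.Hom.hom h
  · have h := φ.comm (i + 1) i
    rw [complex_d, complex_d] at h
    exact congrArg ModuleCat.Hom.hom h

/-- Both `f` and the identity lift the identity of `R/I`, and two lifts to a projective resolution
are homotopic. -/
lemma exists_homotopy {F : MultigradedFreeResolution I}
    (f : ∀ i, (Fin (F.rank i) → MvPolynomial V k) →ₗ[MvPolynomial V k]
      (Fin (F.rank i) → MvPolynomial V k))
    (haug : F.aug ∘ₗ f 0 = F.aug) (hf : ∀ i, F.d i ∘ₗ f (i + 1) = f i ∘ₗ F.d i) :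
    ∃ h : ∀ i, (Fin (F.rank i) → MvPolynomial V k) →ₗ[MvPolynomial V k]
        (Fin (F.rank (i + 1)) → MvPolynomial V k),
      f 0 = F.d 0 ∘ₗ h 0 + LinearMap.id ∧
      ∀ i, f (i + 1) = h i ∘ₗ F.d i + F.d (i + 1) ∘ₗ h (i + 1) + LinearMap.id := by
  let P := F.projectiveResolution
  let H : Homotopy (C := F.complex) (D := F.complex) (complexHom f hf) (𝟙 F.complex) :=
    ProjectiveResolution.liftHomotopy (P := P) (Q := P) (𝟙 _) _ _ (by
      refine HomologicalComplex.to_single_hom_ext ?_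
      simp only [HomologicalComplex.comp_f]
      erw [projectiveResolution_π_f_zero]
      simp
      ext1
      exact haug) (by
        erw [Category.id_comp]
        simp)
  refine ⟨fun i => (H.hom i (i + 1)).hom, ?_, fun i => ?_⟩
  · have h := H.comm 0
    rw [Homotopy.dNext_zero_chainComplex, Homotopy.prevD_chainComplex, complex_d, zero_add] at h
    exact congrArg ModuleCat.Hom.hom h
  · have h := H.comm (i + 1)
    rw [Homotopy.dNext_succ_chainComplex, Homotopy.prevD_chainComplex, complex_d, complex_d] at h
    exact congrArg ModuleCat.Hom.hom h

-- When every differential of `F ⊗ k` is zero, its homology is its terms.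
open MonoidalCategory in
lemma tor'_iso_of_tensoredD_eq_zero (F : MultigradedFreeResolution I)
    (hF : ∀ i, F.tensoredD i = 0) (i : ℕ) :
    Nonempty ((((Tor' (ModuleCat.{max u v} (MvPolynomial V k)) i).obj
        (ModuleCat.of (MvPolynomial V k) (MvPolynomial V k ⧸ I))).obj
        (ModuleCat.of (MvPolynomial V k) (MvPolynomial V k ⧸ irrelevantIdeal k V))) ≅
      ModuleCat.of _ (F.Tensored i)) := by
  let T := (tensoringRight (ModuleCat.{max u v} (MvPolynomial V k))).obj
    (ModuleCat.of (MvPolynomial V k) (MvPolynomial V k ⧸ irrelevantIdeal k V))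
  let K := (T.mapHomologicalComplex (ComplexShape.down ℕ)).obj F.complex
  have hd : ∀ i j, K.d i j = 0 := by
    intro i j
    by_cases h : j + 1 = i
    · subst h
      change T.map (F.complex.d (j + 1) j) = 0
      rw [complex_d]
      ext1
      exact hF j
    · exact K.shape _ _ h
  have e : K.homology i ≅ K.X i :=
    (ShortComplex.HomologyData.ofZeros (K.sc i) (hd _ _) (hd _ _)).left.homologyIso
  exact ⟨F.projectiveResolution.isoLeftDerivedObj T i ≪≫ e⟩

end MultigradedFreeResolution

/-! ### Homogeneous parts of polynomials, of free module elements and of linear maps. -/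

section HomogeneousPart

variable {k : Type u} [Field k] {V : Type v} {ι κ : Type}

open Classical in
/-- The part of degree `a` of a polynomial, regarded as an element of `R(-δ)`. -/
def shiftedPart (δ a : V →₀ ℕ) : MvPolynomial V k →ₗ[k] MvPolynomial V k :=
  if δ ≤ a then MvPolynomial.monomial (a - δ) ∘ₗ MvPolynomial.lcoeff k (a - δ) else 0

open Classical in
lemma coeff_shiftedPart (δ a m : V →₀ ℕ) (p : MvPolynomial V k) :
    (shiftedPart δ a p).coeff m = if m + δ = a then p.coeff m else 0 := by
  unfold shiftedPart
  by_cases h : δ ≤ a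
  · rw [if_pos h]
    have : a - δ = m ↔ m + δ = a := by
      rw [tsub_eq_iff_eq_add_of_le h, eq_comm]
    simp only [LinearMap.comp_apply, MvPolynomial.lcoeff_apply, MvPolynomial.coeff_monomial, this]
    split_ifs with h'
    · rw [this.2 h']
    · rfl
  · rw [if_neg h, if_neg]
    · simp
    · rintro rfl
      exact h le_add_self

lemma shiftedPart_mem (δ a : V →₀ ℕ) (p : MvPolynomial V k) :
    shiftedPart δ a p ∈ MvPolynomial.restrictSupport k {m | m + δ = a} := by
  rw [MvPolynomial.mem_restrictSupport_iff]
  intro m hm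
  by_contra h
  rw [Finset.mem_coe, MvPolynomial.mem_support_iff, coeff_shiftedPart] at hm
  exact hm (if_neg h)

lemma shiftedPart_eq_self {δ a : V →₀ ℕ} {p : MvPolynomial V k}
    (hp : p ∈ MvPolynomial.restrictSupport k {m | m + δ = a}) : shiftedPart δ a p = p := by
  ext m
  rw [coeff_shiftedPart]
  split_ifs with h
  · rfl
  · by_contra h'
    exact h (((MvPolynomial.mem_restrictSupport_iff k).1 hp)
      (MvPolynomial.mem_support_iff.2 (Ne.symm h')))

/-- The hypothesis `h` says that multiplying by a monomial with exponent in `S` carries degree `a`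
(shift `δ`) exactly to degree `a'` (shift `δ'`); the two sides then agree term by term in the Cauchy
product. -/
lemma shiftedPart_mul {S : Set (V →₀ ℕ)} {δ a δ' a' : V →₀ ℕ} {q : MvPolynomial V k}
    (hq : q ∈ MvPolynomial.restrictSupport k S)
    (h : ∀ m ∈ S, ∀ m', m + m' + δ' = a' ↔ m' + δ = a) (p : MvPolynomial V k) :
    shiftedPart δ' a' (q * p) = q * shiftedPart δ a p := by
  classical
  ext m
  rw [coeff_shiftedPart, MvPolynomial.coeff_mul, MvPolynomial.coeff_mul, Finset.ite_sum_zero]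
  refine Finset.sum_congr rfl fun x hx => ?_
  rw [Finset.HasAntidiagonal.mem_antidiagonal] at hx
  rw [coeff_shiftedPart]
  by_cases hq0 : q.coeff x.1 = 0
  · simp [hq0]
  · have hx1 : x.1 ∈ S := (MvPolynomial.mem_restrictSupport_iff k).1 hq
      (MvPolynomial.mem_support_iff.2 hq0)
    rw [← hx, mul_ite, mul_zero]
    exact if_congr (h _ hx1 _) rfl rfl

/-- The projection of the graded free module `⨁ b, R(-deg b)` to its part of degree `a`. -/
def freePart (deg : ι → V →₀ ℕ) (a : V →₀ ℕ) :
    (ι → MvPolynomial V k) →ₗ[k] (ι → MvPolynomial V k) :=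
  LinearMap.pi fun b => shiftedPart (deg b) a ∘ₗ LinearMap.proj b

lemma freePart_apply (deg : ι → V →₀ ℕ) (a : V →₀ ℕ) (x : ι → MvPolynomial V k) (b : ι) :
    freePart deg a x b = shiftedPart (deg b) a (x b) := rfl

lemma mem_freeComponent {deg : ι → V →₀ ℕ} {a : V →₀ ℕ} {x : ι → MvPolynomial V k} :
    x ∈ freeComponent k deg a ↔
      ∀ b, x b ∈ MvPolynomial.restrictSupport k {m | m + deg b = a} := by
  simp [freeComponent, Submodule.mem_pi]

lemma freePart_mem (deg : ι → V →₀ ℕ) (a : V →₀ ℕ) (x : ι → MvPolynomial V k) :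
    freePart deg a x ∈ freeComponent k deg a :=
  mem_freeComponent.2 fun _ => shiftedPart_mem _ _ _

/-- Multiplication by a homogeneous polynomial shifts the degree of components. -/
lemma freePart_smul {deg : ι → V →₀ ℕ} {a c : V →₀ ℕ} {q : MvPolynomial V k}
    (hq : q ∈ MvPolynomial.restrictSupport k {m | m + c = a}) (x : ι → MvPolynomial V k) :
    freePart deg a (q • x) = q • freePart deg c x := by
  funext b
  refine shiftedPart_mul hq (fun m hm m' => ?_) (x b)
  rw [Set.mem_ofPred_eq] at hm
  rw [← hm, add_assoc, add_right_inj]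

lemma linearMap_eq_sum [Fintype ι] [DecidableEq ι] {R M : Type*} [CommRing R] [AddCommGroup M]
    [Module R M] (L : (ι → R) →ₗ[R] M) (x : ι → R) :
    L x = ∑ c, x c • L (Pi.single c 1) := by
  conv_lhs => rw [pi_eq_sum_univ' x]
  simp [map_sum]

/-- A homogeneous linear map commutes with the projections to homogeneous components. -/
lemma map_freePart [Fintype ι] [DecidableEq ι] {deg : ι → V →₀ ℕ} {deg' : κ → V →₀ ℕ}
    {L : (ι → MvPolynomial V k) →ₗ[MvPolynomial V k] (κ → MvPolynomial V k)}
    (hL : ∀ c, L (Pi.single c 1) ∈ freeComponent k deg' (deg c))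
    (a : V →₀ ℕ) (x : ι → MvPolynomial V k) :
    L (freePart deg a x) = freePart deg' a (L x) := by
  rw [linearMap_eq_sum L, linearMap_eq_sum L x, map_sum]
  refine Finset.sum_congr rfl fun c _ => funext fun b => ?_
  rw [freePart_apply, freePart_apply, Pi.smul_apply, Pi.smul_apply, smul_eq_mul, smul_eq_mul,
    mul_comm, mul_comm (x c)]
  refine (shiftedPart_mul (mem_freeComponent.1 (hL c) b) (fun m hm m' => ?_) (x c)).symm
  rw [Set.mem_ofPred_eq] at hm
  rw [← hm, add_right_comm, add_comm m' (m + _), add_right_comm m]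

/-- The homogeneous part of degree `0` of a linear map between graded free modules. -/
def homogeneousHom [Fintype ι] [DecidableEq ι] (deg : ι → V →₀ ℕ) (deg' : κ → V →₀ ℕ)
    (L : (ι → MvPolynomial V k) →ₗ[MvPolynomial V k] (κ → MvPolynomial V k)) :
    (ι → MvPolynomial V k) →ₗ[MvPolynomial V k] (κ → MvPolynomial V k) :=
  (Pi.basisFun (MvPolynomial V k) ι).constr (MvPolynomial V k)
    fun c => freePart deg' (deg c) (L (Pi.single c 1))

lemma homogeneousHom_single [Fintype ι] [DecidableEq ι] (deg : ι → V →₀ ℕ) (deg' : κ → V →₀ ℕ)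
    (L : (ι → MvPolynomial V k) →ₗ[MvPolynomial V k] (κ → MvPolynomial V k)) (c : ι) :
    homogeneousHom deg deg' L (Pi.single c 1) = freePart deg' (deg c) (L (Pi.single c 1)) := by
  have := (Pi.basisFun (MvPolynomial V k) ι).constr_basis (MvPolynomial V k)
    (fun c => freePart deg' (deg c) (L (Pi.single c 1))) c
  rwa [Pi.basisFun_apply] at this

lemma homogeneousHom_of_mem [Fintype ι] [DecidableEq ι] {deg : ι → V →₀ ℕ}
    (deg' : κ → V →₀ ℕ)
    (L : (ι → MvPolynomial V k) →ₗ[MvPolynomial V k] (κ → MvPolynomial V k))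
    {a : V →₀ ℕ} {x : ι → MvPolynomial V k} (hx : x ∈ freeComponent k deg a) :
    homogeneousHom deg deg' L x = freePart deg' a (L x) := by
  rw [linearMap_eq_sum _ x, linearMap_eq_sum L x, map_sum]
  refine Finset.sum_congr rfl fun c _ => ?_
  rw [homogeneousHom_single, freePart_smul (mem_freeComponent.1 hx c)]

lemma homogeneousHom_mem [Fintype ι] [DecidableEq ι] {deg : ι → V →₀ ℕ}
    (deg' : κ → V →₀ ℕ)
    (L : (ι → MvPolynomial V k) →ₗ[MvPolynomial V k] (κ → MvPolynomial V k))
    {a : V →₀ ℕ} {x : ι → MvPolynomial V k} (hx : x ∈ freeComponent k deg a) :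
    homogeneousHom deg deg' L x ∈ freeComponent k deg' a := by
  rw [homogeneousHom_of_mem deg' L hx]
  exact freePart_mem _ _ _

/-- Each coordinate `b` contributes at most the single monomial with exponent `a - deg b`.
Finiteness is what allows `finrank` to be compared along injections. -/
instance finite_freeComponent [Finite ι] (deg : ι → V →₀ ℕ) (a : V →₀ ℕ) :
    Module.Finite k (freeComponent k deg a) := by
  refine Module.Finite.of_injective (N := ι → k)
    ((LinearMap.pi fun b => MvPolynomial.lcoeff k (a - deg b) ∘ₗ LinearMap.proj b) ∘ₗ
      (freeComponent k deg a).subtype) ?_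
  rw [injective_iff_map_eq_zero]
  rintro ⟨x, hx⟩ h
  refine Subtype.ext (funext fun b => ?_)
  ext m
  by_contra hm
  have hma : m + deg b = a := (MvPolynomial.mem_restrictSupport_iff k).1
    (mem_freeComponent.1 hx b) (MvPolynomial.mem_support_iff.2 hm)
  have hb : (x b).coeff (a - deg b) = 0 := congrFun h b
  rw [← hma, add_tsub_cancel_right] at hb
  exact hm hb

end HomogeneousPart

/-! ### Independence of the Tor components from the resolution. -/

/-- An ideal that contains the homogeneous parts of its elements. -/
def IsMultihomogeneous {k : Type u} [Field k] {V : Type v} (I : Ideal (MvPolynomial V k)) : Prop :=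
  ∀ p ∈ I, ∀ a, shiftedPart 0 a p ∈ I

namespace MultigradedFreeResolution

variable {k : Type u} [Field k] {V : Type v} {I : Ideal (MvPolynomial V k)}

/-- An equation in `R/I` is a membership in `I` of a difference of polynomials. Multihomogeneity of
`I` lets one pass to the degree `a` part of that difference. -/
lemma aug_freePart_sub_mem (F : MultigradedFreeResolution I) (hI : IsMultihomogeneous I)
    {a : V →₀ ℕ} {y : Fin (F.rank 0) → MvPolynomial V k} {p : MvPolynomial V k}
    (hp : p ∈ MvPolynomial.restrictSupport k {a}) (hy : F.aug y = Ideal.Quotient.mk I p) :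
    F.aug (freePart (F.deg 0) a y) = Ideal.Quotient.mk I p := by
  choose P hP hPaug using F.aug_homogeneous
  have key : ∀ z, F.aug z = Ideal.Quotient.mk I (∑ b, z b * P b) := by
    intro z
    rw [linearMap_eq_sum F.aug z, map_sum]
    refine Finset.sum_congr rfl fun b _ => ?_
    rw [hPaug, map_mul]
    rfl
  have hpa : shiftedPart 0 a p = p := shiftedPart_eq_self (by simpa using hp)
  rw [key, Ideal.Quotient.eq] at hy ⊢
  have h := hI _ hy a
  rw [map_sub, hpa, map_sum] at h
  convert h using 3 with b
  rw [freePart_apply, mul_comm, mul_comm (y b)]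
  refine (shiftedPart_mul (hP b) ?_ (y b)).symm
  rintro m rfl m'
  rw [add_zero, add_comm]

/-- Between two multigraded free resolutions there is a homogeneous chain map. -/
lemma exists_homogeneous_lift (F G : MultigradedFreeResolution I) (hI : IsMultihomogeneous I) :
    ∃ f : ∀ i, (Fin (F.rank i) → MvPolynomial V k) →ₗ[MvPolynomial V k]
        (Fin (G.rank i) → MvPolynomial V k),
      G.aug ∘ₗ f 0 = F.aug ∧ (∀ i, G.d i ∘ₗ f (i + 1) = f i ∘ₗ F.d i) ∧
      ∀ i a, ∀ x ∈ freeComponent k (F.deg i) a, f i x ∈ freeComponent k (G.deg i) a := by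
  obtain ⟨f, hf, hfd⟩ := exists_lift F G
  refine ⟨fun i => homogeneousHom (F.deg i) (G.deg i) (f i), ?_, fun i => ?_,
    fun i a x hx => homogeneousHom_mem _ _ hx⟩
  · refine (Pi.basisFun (MvPolynomial V k) _).ext fun c => ?_
    obtain ⟨p, hp, hpc⟩ := F.aug_homogeneous c
    rw [Pi.basisFun_apply, LinearMap.comp_apply, homogeneousHom_single, hpc]
    refine aug_freePart_sub_mem G hI hp ?_
    rw [← hpc, ← hf]
    rfl
  · refine (Pi.basisFun (MvPolynomial V k) _).ext fun c => ?_
    rw [Pi.basisFun_apply, LinearMap.comp_apply, LinearMap.comp_apply, homogeneousHom_single,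
      homogeneousHom_of_mem _ _ (F.d_homogeneous i c), map_freePart (G.d_homogeneous i)]
    exact congrArg _ (LinearMap.congr_fun (hfd i) _)

instance finite_tensoredComponent (F : MultigradedFreeResolution I) (i : ℕ) (a : V →₀ ℕ) :
    Module.Finite k (F.tensoredComponent i a) :=
  Module.Finite.map _ _

instance finite_torComponent (F : MultigradedFreeResolution I) (i : ℕ) (a : V →₀ ℕ) :
    Module.Finite k (F.torComponent i a) := by
  have : Module.Finite k
      ↥(F.tensoredComponent i a ⊓ (F.cycles i).restrictScalars k) :=
    Submodule.finiteDimensional_of_le inf_le_left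
  exact Module.Finite.map _ _

/-- Only the map `f : F → G` has to be homogeneous, so that it sends `torComponent` to
`torComponent`. The return map `g` serves only to show injectivity, because `g ∘ f` is homotopic to
the identity; it may be any lift. -/
theorem finrank_torComponent_le (F G : MultigradedFreeResolution I) (hI : IsMultihomogeneous I)
    (i : ℕ) (a : V →₀ ℕ) :
    Module.finrank k (F.torComponent i a) ≤ Module.finrank k (G.torComponent i a) := by
  obtain ⟨f, hf, hfd, hfhom⟩ := exists_homogeneous_lift F G hI
  obtain ⟨g, hg, hgd⟩ := exists_lift G F
  obtain ⟨h, h0, hs⟩ := exists_homotopy (F := F) (fun i => g i ∘ₗ f i)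
    (by rw [← LinearMap.comp_assoc, hg, hf])
    (fun i => by
      rw [← LinearMap.comp_assoc, hgd, LinearMap.comp_assoc, hfd, LinearMap.comp_assoc])
  let φ : ∀ i, F.Tensored i →ₗ[MvPolynomial V k] G.Tensored i :=
    fun i => (f i).rTensor (MvPolynomial V k ⧸ irrelevantIdeal k V)
  let ψ : ∀ i, G.Tensored i →ₗ[MvPolynomial V k] F.Tensored i :=
    fun i => (g i).rTensor (MvPolynomial V k ⧸ irrelevantIdeal k V)
  have hφd : ∀ i x, G.tensoredD i (φ (i + 1) x) = φ i (F.tensoredD i x) := fun i x => by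
    have := congrArg (LinearMap.rTensor (MvPolynomial V k ⧸ irrelevantIdeal k V)) (hfd i)
    rw [LinearMap.rTensor_comp, LinearMap.rTensor_comp] at this
    exact LinearMap.congr_fun this x
  have hψd : ∀ i x, F.tensoredD i (ψ (i + 1) x) = ψ i (G.tensoredD i x) := fun i x => by
    have := congrArg (LinearMap.rTensor (MvPolynomial V k ⧸ irrelevantIdeal k V)) (hgd i)
    rw [LinearMap.rTensor_comp, LinearMap.rTensor_comp] at this
    exact LinearMap.congr_fun this x
  have hhom : ∀ i, ∀ x ∈ F.cycles i, ψ i (φ i x) - x ∈ LinearMap.range (F.tensoredD i) := by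
    rintro (_ | i) x hx
    · have := LinearMap.congr_fun
        (congrArg (LinearMap.rTensor (MvPolynomial V k ⧸ irrelevantIdeal k V)) h0) x
      rw [LinearMap.rTensor_comp, LinearMap.rTensor_add, LinearMap.rTensor_comp,
        LinearMap.rTensor_id] at this
      exact ⟨_, (sub_eq_of_eq_add this).symm⟩
    · have := LinearMap.congr_fun
        (congrArg (LinearMap.rTensor (MvPolynomial V k ⧸ irrelevantIdeal k V)) (hs i)) x
      rw [LinearMap.rTensor_comp, LinearMap.rTensor_add, LinearMap.rTensor_add,
        LinearMap.rTensor_comp, LinearMap.rTensor_comp, LinearMap.rTensor_id] at this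
      have hx' : (F.d i).rTensor (MvPolynomial V k ⧸ irrelevantIdeal k V) x = 0 := hx
      simp only [LinearMap.add_apply, LinearMap.comp_apply, hx', map_zero, zero_add] at this
      exact ⟨_, (sub_eq_of_eq_add this).symm⟩
  let Φ : (F.Tensored i ⧸ LinearMap.range (F.tensoredD i)) →ₗ[MvPolynomial V k]
      (G.Tensored i ⧸ LinearMap.range (G.tensoredD i)) :=
    Submodule.mapQ _ _ (φ i) (by
      rintro _ ⟨x, rfl⟩
      exact ⟨_, hφd i x⟩)
  have hmaps : ∀ z ∈ F.torComponent i a, Φ.restrictScalars k z ∈ G.torComponent i a := by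
    rintro _ ⟨x, ⟨⟨y, hy, rfl⟩, hx⟩, rfl⟩
    refine ⟨_, ⟨⟨f i y, hfhom i a y hy, rfl⟩, ?_⟩, rfl⟩
    cases i with
    | zero => trivial
    | succ i =>
      have := hφd i (y ⊗ₜ 1)
      rw [show F.tensoredD i (y ⊗ₜ 1) = 0 from hx, map_zero] at this
      exact this
  refine LinearMap.finrank_le_finrank_of_injective
    (f := (Φ.restrictScalars k).restrict hmaps) ?_
  rw [injective_iff_map_eq_zero]
  rintro ⟨_, x, ⟨_, hx⟩, rfl⟩ hz
  have h1 : φ i x ∈ LinearMap.range (G.tensoredD i) :=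
    (Submodule.Quotient.mk_eq_zero _).1 (congrArg Subtype.val hz)
  refine Subtype.ext <| (Submodule.Quotient.mk_eq_zero _).2 ?_
  obtain ⟨y, hy⟩ := h1
  have h2 := hhom i x hx
  rw [← hy, ← hψd] at h2
  -- The class of `x` vanishes: `x = d(ψ y) - (ψ (φ x) - x)`, and both terms are boundaries.
  have h3 := Submodule.sub_mem _ (LinearMap.mem_range_self _ (ψ (i + 1) y)) h2
  rwa [sub_sub_cancel] at h3

end MultigradedFreeResolution

lemma multigradedBetti_eq {k : Type u} [Field k] {V : Type v} {I : Ideal (MvPolynomial V k)}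
    (hI : IsMultihomogeneous I) (G : MultigradedFreeResolution I) (i : ℕ) (a : V →₀ ℕ) :
    multigradedBetti I i a = Module.finrank k (G.torComponent i a) := by
  rw [multigradedBetti, dif_pos ⟨G⟩]
  exact le_antisymm (MultigradedFreeResolution.finrank_torComponent_le _ _ hI i a)
    (MultigradedFreeResolution.finrank_torComponent_le _ _ hI i a)

/-! ### The residue field and the Betti numbers of a minimal resolution. -/

section Residue

variable (k : Type u) [Field k] (V : Type v)

lemma mem_irrelevantIdeal {p : MvPolynomial V k} :
    p ∈ irrelevantIdeal k V ↔ MvPolynomial.constantCoeff p = 0 := by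
  rw [irrelevantIdeal, ← Set.image_univ, MvPolynomial.mem_ideal_span_X_image,
    MvPolynomial.constantCoeff_eq]
  constructor
  · intro h
    by_contra h0
    obtain ⟨i, -, hi⟩ := h 0 (MvPolynomial.mem_support_iff.2 h0)
    exact hi rfl
  · intro h m hm
    by_contra! h0
    have : m = 0 := Finsupp.ext fun i => h0 i trivial
    rw [this] at hm
    exact MvPolynomial.mem_support_iff.1 hm h

lemma irrelevantIdeal_eq_ker : irrelevantIdeal k V =
    RingHom.ker (MvPolynomial.aeval (fun _ => 0) : MvPolynomial V k →ₐ[k] k) := by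
  ext p
  rw [mem_irrelevantIdeal, RingHom.mem_ker, MvPolynomial.aeval_zero']
  rfl

/-- The residue field of the ideal of all variables is `k`. -/
def residueEquiv : (MvPolynomial V k ⧸ irrelevantIdeal k V) ≃ₐ[k] k :=
  (Ideal.quotientEquivAlgOfEq k (irrelevantIdeal_eq_ker k V)).trans
    (Ideal.quotientKerAlgEquivOfSurjective fun c => ⟨MvPolynomial.C c, by simp⟩)

lemma residueEquiv_mk (p : MvPolynomial V k) :
    residueEquiv k V (Ideal.Quotient.mk _ p) = MvPolynomial.constantCoeff p :=
  MvPolynomial.aeval_zero' p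

end Residue

namespace MultigradedFreeResolution

variable {k : Type u} [Field k] {V : Type v} {I : Ideal (MvPolynomial V k)}

/-- The terms of the complex `F ⊗ k` are `k`-spaces with a standard basis. -/
def tensoredEquiv (F : MultigradedFreeResolution I) (i : ℕ) :
    F.Tensored i ≃ₗ[k] (Fin (F.rank i) → k) :=
  ((TensorProduct.comm (MvPolynomial V k) _ _ ≪≫ₗ
    TensorProduct.piScalarRight (MvPolynomial V k) (MvPolynomial V k)
      (MvPolynomial V k ⧸ irrelevantIdeal k V) (Fin (F.rank i))).restrictScalars k) ≪≫ₗ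
    LinearEquiv.piCongrRight fun _ => (residueEquiv k V).toLinearEquiv

lemma tensoredEquiv_tmul (F : MultigradedFreeResolution I) (i : ℕ)
    (x : Fin (F.rank i) → MvPolynomial V k) (p : MvPolynomial V k) (b : Fin (F.rank i)) :
    F.tensoredEquiv i (x ⊗ₜ Ideal.Quotient.mk _ p) b =
      MvPolynomial.constantCoeff (x b) * MvPolynomial.constantCoeff p := by
  rw [← map_mul, ← residueEquiv_mk]
  rfl

/-- A multigraded free resolution is minimal if no entry of a differential is invertible. -/
def IsMinimal (F : MultigradedFreeResolution I) : Prop :=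
  ∀ i c b, MvPolynomial.constantCoeff (F.d i (Pi.single c 1) b) = 0

lemma IsMinimal.tensoredD_eq_zero {F : MultigradedFreeResolution I} (hF : F.IsMinimal) (i : ℕ) :
    F.tensoredD i = 0 := by
  refine TensorProduct.ext' fun x y => ?_
  obtain ⟨p, rfl⟩ := Ideal.Quotient.mk_surjective y
  refine (F.tensoredEquiv i).injective (funext fun b => ?_)
  rw [LinearMap.zero_apply, map_zero, Pi.zero_apply]
  refine (F.tensoredEquiv_tmul i _ _ _).trans ?_
  rw [linearMap_eq_sum, Finset.sum_apply, map_sum, Finset.sum_eq_zero, zero_mul]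
  intro c _
  rw [Pi.smul_apply, smul_eq_mul, map_mul, hF, mul_zero]

lemma finrank_tensored (F : MultigradedFreeResolution I) (i : ℕ) :
    Module.finrank k (F.Tensored i) = F.rank i := by
  rw [(F.tensoredEquiv i).finrank_eq, Module.finrank_fin_fun]

/-- The entry at `b` of an element of degree `a` is a multiple of the monomial `x ^ (a - deg b)`,
whose constant term survives only if `deg b = a`. So the degree `a` part of `F i ⊗ k` is spanned by
the basis vectors of multidegree exactly `a`. -/
lemma map_tensoredComponent (F : MultigradedFreeResolution I) (i : ℕ) (a : V →₀ ℕ) :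
    (F.tensoredComponent i a).map (F.tensoredEquiv i).toLinearMap =
      LinearMap.range (Function.ExtendByZero.linearMap k
        (Subtype.val : {b // F.deg i b = a} → Fin (F.rank i))) := by
  have hval : Function.Injective (Subtype.val : {b // F.deg i b = a} → Fin (F.rank i)) :=
    Subtype.val_injective
  ext y
  constructor
  · rintro ⟨_, ⟨x, hx, rfl⟩, rfl⟩
    refine ⟨fun b => MvPolynomial.constantCoeff (x b), funext fun b => ?_⟩
    refine Eq.trans ?_ (F.tensoredEquiv_tmul i x 1 b).symm
    rw [map_one, mul_one]
    by_cases hb : F.deg i b = a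
    · exact hval.extend_apply (fun b : {b // F.deg i b = a} =>
        MvPolynomial.constantCoeff (x b)) 0 ⟨b, hb⟩
    · refine (Function.extend_apply' (fun b : {b // F.deg i b = a} =>
        MvPolynomial.constantCoeff (x b)) (0 : Fin (F.rank i) → k) b ?_).trans ?_
      · rintro ⟨⟨c, hc⟩, rfl⟩
        exact hb hc
      · rw [Pi.zero_apply, MvPolynomial.constantCoeff_eq]
        by_contra h
        have h' : 0 + F.deg i b = a := (MvPolynomial.mem_restrictSupport_iff k).1
          (mem_freeComponent.1 hx b) (MvPolynomial.mem_support_iff.2 (Ne.symm h))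
        exact hb (by rw [← h', zero_add])
  · rintro ⟨y, rfl⟩
    refine ⟨_, ⟨fun b => MvPolynomial.C (Function.ExtendByZero.linearMap k Subtype.val y b),
      mem_freeComponent.2 fun b => ?_, rfl⟩, funext fun b => ?_⟩
    · refine (MvPolynomial.monomial_mem_restrictSupport k).2 ?_
      by_cases hb : F.deg i b = a
      · left
        rw [Set.mem_ofPred_eq, hb, zero_add]
      · right
        refine Function.extend_apply' _ _ _ ?_
        rintro ⟨⟨c, hc⟩, rfl⟩
        exact hb hc
    · refine (F.tensoredEquiv_tmul i _ 1 b).trans ?_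
      rw [map_one, mul_one, MvPolynomial.constantCoeff_C]

lemma finrank_tensoredComponent [DecidableEq V] (F : MultigradedFreeResolution I) (i : ℕ)
    (a : V →₀ ℕ) :
    Module.finrank k (F.tensoredComponent i a) =
      (Finset.univ.filter fun b => F.deg i b = a).card := by
  rw [← LinearEquiv.finrank_map_eq (F.tensoredEquiv i), map_tensoredComponent,
    LinearMap.finrank_range_of_inj, Module.finrank_fintype_fun_eq_card, Fintype.card_subtype]
  intro x y hxy
  funext b
  have := congrFun hxy b.1
  have e : ∀ z, Function.ExtendByZero.linearMap k
      (Subtype.val : {b // F.deg i b = a} → Fin (F.rank i)) z b.1 = z b :=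
    fun z => Subtype.val_injective.extend_apply _ _ b
  rwa [e, e] at this

/-- With zero differentials everything is a cycle and only `0` is a boundary. -/
lemma IsMinimal.finrank_torComponent [DecidableEq V] {F : MultigradedFreeResolution I}
    (hF : F.IsMinimal) (i : ℕ) (a : V →₀ ℕ) :
    Module.finrank k (F.torComponent i a) =
      (Finset.univ.filter fun b => F.deg i b = a).card := by
  have hcycles : F.cycles i = ⊤ := by
    cases i with
    | zero => rfl
    | succ i =>
      change LinearMap.ker (F.tensoredD i) = ⊤
      rw [hF.tensoredD_eq_zero, LinearMap.ker_zero]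
  have hinj : Function.Injective
      ((LinearMap.range (F.tensoredD i)).mkQ.restrictScalars k) := by
    change Function.Injective (LinearMap.range (F.tensoredD i)).mkQ
    rw [← LinearMap.ker_eq_bot, Submodule.ker_mkQ, hF.tensoredD_eq_zero, LinearMap.range_zero]
  rw [torComponent, hcycles, Submodule.restrictScalars_top, inf_top_eq,
    ← (Submodule.equivMapOfInjective _ hinj _).finrank_eq, finrank_tensoredComponent]

lemma IsMinimal.finrank_tor' {F : MultigradedFreeResolution I} (hF : F.IsMinimal) (i : ℕ) :
    Module.finrank k
      ((ModuleCat.restrictScalars (algebraMap k (MvPolynomial V k))).obj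
        (((Tor' (ModuleCat.{max u v} (MvPolynomial V k)) i).obj
          (ModuleCat.of (MvPolynomial V k) (MvPolynomial V k ⧸ I))).obj
          (ModuleCat.of (MvPolynomial V k) (MvPolynomial V k ⧸ irrelevantIdeal k V)))) =
      F.rank i := by
  obtain ⟨e⟩ := F.tor'_iso_of_tensoredD_eq_zero hF.tensoredD_eq_zero i
  rw [((ModuleCat.restrictScalars (algebraMap k (MvPolynomial V k))).mapIso
    e).toLinearEquiv.finrank_eq]
  refine Eq.trans ?_ (F.finrank_tensored i)
  -- The two `k`-actions, one through `algebraMap` and one direct, agree by the scalar tower.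
  let e' : ((ModuleCat.restrictScalars (algebraMap k (MvPolynomial V k))).obj
      (ModuleCat.of _ (F.Tensored i))) ≃ₗ[k] F.Tensored i :=
    { AddEquiv.refl (F.Tensored i) with
      map_smul' := fun c x =>
        algebraMap_smul (M := F.Tensored i) (MvPolynomial V k) c x }
  exact e'.finrank_eq

end MultigradedFreeResolution

/-! ### Exactness of Koszul complexes by contracting one variable at a time. -/

section Koszul

variable {k : Type u} [Field k] {V : Type v}

/-- Division by a variable, deleting the monomials that it does not divide. -/
def divX (c : V) : MvPolynomial V k →ₗ[k] MvPolynomial V k where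
  toFun p := MvPolynomial.divMonomial p (Finsupp.single c 1)
  map_add' p q := MvPolynomial.add_divMonomial _ _ _
  map_smul' r p := by
    ext m
    simp [MvPolynomial.coeff_divMonomial]

lemma divX_X_mul_self (c : V) (p : MvPolynomial V k) :
    divX c (MvPolynomial.X c * p) = p :=
  MvPolynomial.X_mul_divMonomial c p

variable [LinearOrder V]

/-- The sign `(-1)^#{t ∈ T | t < j}`. -/
def koszulSign (j : V) (T : Finset V) : ℤ := (-1) ^ (T.filter (· < j)).card

lemma koszulSign_mul_self (j : V) (T : Finset V) : koszulSign j T * koszulSign j T = 1 := by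
  rw [koszulSign, ← mul_pow]
  simp

lemma koszulSign_insert_self (j : V) (T : Finset V) :
    koszulSign j (insert j T) = koszulSign j T := by
  rw [koszulSign, koszulSign, Finset.filter_insert, if_neg (lt_irrefl j)]

lemma koszulSign_insert {j l : V} {T : Finset V} (hl : l ∉ T) :
    koszulSign j (insert l T) = if l < j then - koszulSign j T else koszulSign j T := by
  rw [koszulSign, koszulSign, Finset.filter_insert]
  split_ifs with h
  · rw [Finset.card_insert_of_notMem (by simp [hl]), pow_succ, mul_neg_one]
  · rfl

/-- Exactly one of `j < l` and `l < j` holds, so exactly one of the two signs flips. -/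
lemma koszulSign_swap {j l : V} {T : Finset V} (hj : j ∉ T) (hl : l ∉ T) (h : j ≠ l) :
    koszulSign j (insert l T) * koszulSign l (insert j T) =
      - (koszulSign j T * koszulSign l T) := by
  rw [koszulSign_insert hj, koszulSign_insert hl]
  rcases lt_or_gt_of_ne h with h | h
  · rw [if_pos h, if_neg h.not_gt, mul_neg]
  · rw [if_pos h, if_neg h.not_gt, neg_mul]

lemma koszulSign_anticomm {j l : V} {T : Finset V} (hj : j ∉ T) (hl : l ∉ T) (h : j ≠ l) :
    koszulSign j T * koszulSign l (insert j T) =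
      - (koszulSign l T * koszulSign j (insert l T)) := by
  rw [koszulSign_insert hj, koszulSign_insert hl]
  rcases lt_or_gt_of_ne h with h | h
  · rw [if_pos h, if_neg h.not_gt]; ring
  · rw [if_pos h, if_neg h.not_gt]; ring

lemma divX_X_mul {c j : V} (h : j ≠ c) (p : MvPolynomial V k) :
    divX c (MvPolynomial.X j * p) = MvPolynomial.X j * divX c p := by
  ext m
  change (MvPolynomial.divMonomial _ _).coeff m = _
  rw [MvPolynomial.coeff_divMonomial, MvPolynomial.coeff_X_mul', MvPolynomial.coeff_X_mul']
  have hs : j ∈ (Finsupp.single c 1 + m).support ↔ j ∈ m.support := by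
    simp [h.symm]
  rw [if_congr hs rfl rfl]
  split_ifs with hj
  · change _ = (MvPolynomial.divMonomial _ _).coeff _
    -- Since `j` lies in the support of `m`, the truncated subtraction is an honest one.
    rw [MvPolynomial.coeff_divMonomial, add_tsub_assoc_of_le]
    rw [Finsupp.single_le_iff, Nat.one_le_iff_ne_zero]
    exact Finsupp.mem_support_iff.1 hj
  · rfl

/-- The contraction of the Koszul complex in the direction of the variable `c`. -/
def koszulContraction (c : V) (f : Finset V → MvPolynomial V k) :
    Finset V → MvPolynomial V k :=
  fun T => if c ∈ T then koszulSign c T • divX c (f (T.erase c)) else 0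

/-- The projection that is homotopic to the identity by `koszulContraction c`. -/
def koszulResidue (c : V) (f : Finset V → MvPolynomial V k) : Finset V → MvPolynomial V k :=
  fun T => if c ∈ T then 0 else f T - MvPolynomial.X c * divX c (f T)

/-- A family of polynomials supported on the `p`-element sets that contain `S`. -/
def IsKoszulChain (S : Finset V) (p : ℕ) (f : Finset V → MvPolynomial V k) : Prop :=
  ∀ T, f T ≠ 0 → S ⊆ T ∧ T.card = p

lemma IsKoszulChain.contraction {S : Finset V} {p : ℕ} {f : Finset V → MvPolynomial V k}
    (hf : IsKoszulChain S p f) (c : V) : IsKoszulChain S (p + 1) (koszulContraction c f) := by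
  intro T hT
  rw [koszulContraction] at hT
  split_ifs at hT with hc
  · have hne : f (T.erase c) ≠ 0 := by
      intro h0
      rw [h0, map_zero, smul_zero] at hT
      exact hT rfl
    obtain ⟨h1, h2⟩ := hf _ hne
    exact ⟨h1.trans (Finset.erase_subset c T), by rw [← h2, Finset.card_erase_add_one hc]⟩
  · exact absurd rfl hT

lemma koszulResidue_ne_zero {c : V} {f : Finset V → MvPolynomial V k} {T : Finset V}
    (h : koszulResidue c f T ≠ 0) : c ∉ T ∧ f T ≠ 0 := by
  rw [koszulResidue] at h
  split_ifs at h with hc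
  · exact absurd rfl h
  · refine ⟨hc, fun h0 => h ?_⟩
    rw [h0, map_zero, mul_zero, sub_zero]

/-- Erasing `c ∉ S` from a superset of `S` leaves a superset of `S`. Conditions are imposed only on
`T ⊇ S`, because `koszulD` also produces values on sets that have lost elements of `S`, and these do
not belong to the complex of the variables outside `S`. -/
lemma koszulContraction_eq_zero {S : Finset V} {f : Finset V → MvPolynomial V k}
    (hf : ∀ T, S ⊆ T → f T = 0) {c : V} (hc : c ∉ S) {T : Finset V} (hT : S ⊆ T) :
    koszulContraction c f T = 0 := by
  rw [koszulContraction]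
  split_ifs
  · rw [hf _ (Finset.subset_erase.2 ⟨hT, hc⟩), map_zero, smul_zero]
  · rfl

variable [Fintype V]

/-- The Koszul differential of all variables, on families indexed by subsets. -/
def koszulD : (Finset V → MvPolynomial V k) →ₗ[MvPolynomial V k] (Finset V → MvPolynomial V k) :=
  LinearMap.pi fun T => ∑ j ∈ Tᶜ,
    koszulSign j T • ((MvPolynomial.X j : MvPolynomial V k) •
      (LinearMap.proj (insert j T) :
        (Finset V → MvPolynomial V k) →ₗ[MvPolynomial V k] MvPolynomial V k))

lemma koszulD_apply (f : Finset V → MvPolynomial V k) (T : Finset V) :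
    koszulD f T = ∑ j ∈ Tᶜ, koszulSign j T • (MvPolynomial.X j * f (insert j T)) := by
  simp [koszulD, mul_left_comm]

lemma koszulD_congr {f g : Finset V → MvPolynomial V k} {T : Finset V}
    (h : ∀ j ∉ T, f (insert j T) = g (insert j T)) : koszulD f T = koszulD g T := by
  rw [koszulD_apply, koszulD_apply]
  refine Finset.sum_congr rfl fun j hj => ?_
  rw [h j (Finset.mem_compl.1 hj)]

lemma koszulD_eq_zero {f : Finset V → MvPolynomial V k} {T : Finset V}
    (h : ∀ j ∉ T, f (insert j T) = 0) : koszulD f T = 0 := by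
  rw [koszulD_congr (g := 0) h, map_zero, Pi.zero_apply]

/-- The terms that insert `j, l` in the two orders cancel by `koszulSign_anticomm`. -/
lemma koszulD_koszulD (f : Finset V → MvPolynomial V k) : koszulD (koszulD f) = 0 := by
  funext T
  simp only [koszulD_apply, Pi.zero_apply, Finset.mul_sum, Finset.smul_sum]
  rw [Finset.sum_sigma']
  refine Finset.sum_involution (fun x _ => ⟨x.2, x.1⟩) ?_ ?_ ?_ ?_
  · rintro ⟨j, l⟩ h
    simp only [Finset.mem_sigma, Finset.mem_compl, Finset.mem_insert, not_or] at h
    obtain ⟨hj, hlj, hl⟩ := h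
    simp only [mul_smul_comm, smul_smul]
    rw [koszulSign_anticomm hj hl (Ne.symm hlj), Finset.insert_comm l j T, neg_smul,
      mul_left_comm (MvPolynomial.X j), neg_add_cancel]
  · rintro ⟨j, l⟩ h - heq
    simp only [Finset.mem_sigma, Finset.mem_compl, Finset.mem_insert, not_or] at h
    simp only [Sigma.mk.injEq, heq_eq_eq] at heq
    exact h.2.1 heq.1
  · rintro ⟨j, l⟩ h
    simp only [Finset.mem_sigma, Finset.mem_compl, Finset.mem_insert, not_or] at h ⊢
    exact ⟨h.2.2, Ne.symm h.2.1, h.1⟩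
  · rintro ⟨j, l⟩ -
    rfl

/-- For `c ∈ T`, the terms inserting `j ≠ c` cancel between the two composites, and inserting `c`
returns `f T` because `divX c` undoes `X c`. For `c ∉ T`, only `j = c` survives, giving `X c * divX
c (f T)`. -/
lemma koszul_homotopy (c : V) (f : Finset V → MvPolynomial V k) :
    koszulResidue c f =
      f - koszulD (koszulContraction c f) - koszulContraction c (koszulD f) := by
  funext T
  rw [Pi.sub_apply, Pi.sub_apply]
  by_cases hc : c ∈ T
  · obtain ⟨T, hcT, rfl⟩ : ∃ T', c ∉ T' ∧ insert c T' = T :=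
      ⟨T.erase c, Finset.notMem_erase c T, Finset.insert_erase hc⟩
    have hcompl : Tᶜ = insert c (insert c T)ᶜ := by
      ext j
      by_cases hj : j = c <;> simp [hj, hcT]
    have h2 : koszulContraction c (koszulD f) (insert c T) = f (insert c T) +
        ∑ j ∈ (insert c T)ᶜ, koszulSign c T • koszulSign j T •
          (MvPolynomial.X j * divX c (f (insert j T))) := by
      rw [koszulContraction, if_pos hc, Finset.erase_insert hcT, koszulD_apply, map_sum,
        hcompl, Finset.sum_insert (by simp), smul_add, Finset.smul_sum, map_zsmul,
        divX_X_mul_self, koszulSign_insert_self, smul_smul, koszulSign_mul_self, one_smul]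
      congr 1
      refine Finset.sum_congr rfl fun j hj => ?_
      simp only [Finset.mem_compl, Finset.mem_insert, not_or] at hj
      rw [map_zsmul, divX_X_mul hj.1]
    have h1 : koszulD (koszulContraction c f) (insert c T) =
        - ∑ j ∈ (insert c T)ᶜ, koszulSign c T • koszulSign j T •
          (MvPolynomial.X j * divX c (f (insert j T))) := by
      rw [koszulD_apply, ← Finset.sum_neg_distrib]
      refine Finset.sum_congr rfl fun j hj => ?_
      simp only [Finset.mem_compl, Finset.mem_insert, not_or] at hj
      rw [koszulContraction, if_pos (by simp), Finset.insert_comm, koszulSign_insert_self,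
        Finset.erase_insert (by simp [hcT, Ne.symm hj.1]), mul_smul_comm, smul_smul, smul_smul,
        koszulSign_swap hj.2 hcT hj.1, neg_smul, mul_comm]
    rw [h1, h2, koszulResidue, if_pos hc]
    ring
  · rw [koszulResidue, if_neg hc, koszulContraction, if_neg hc, koszulD_apply,
      Finset.sum_eq_single_of_mem c (Finset.mem_compl.2 hc), koszulContraction,
      if_pos (Finset.mem_insert_self c T), koszulSign_insert_self, Finset.erase_insert hc,
      mul_smul_comm, smul_smul, koszulSign_mul_self, one_smul, sub_zero]
    intro j hj hjc
    rw [koszulContraction, if_neg (by simp [hc, Ne.symm hjc]), mul_zero, smul_zero]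

/-- The Koszul complex of the variables outside `S` is exact in positive degrees. -/
theorem koszul_exact {S : Finset V} {p : ℕ} (hp : S.card < p) {f : Finset V → MvPolynomial V k}
    (hf : IsKoszulChain S p f) (hd : ∀ T, S ⊆ T → koszulD f T = 0) :
    ∃ g, IsKoszulChain S (p + 1) g ∧ ∀ T, S ⊆ T → koszulD g T = f T := by
  -- Contract the variables of `C` successively: modulo boundaries, `f` is replaced by a cycle `f'`
  -- supported on sets disjoint from `C`.
  have key : ∀ C : Finset V, Disjoint C S → ∃ f' g : Finset V → MvPolynomial V k,
      IsKoszulChain S p f' ∧ (∀ T, S ⊆ T → koszulD f' T = 0) ∧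
      (∀ T, f' T ≠ 0 → Disjoint C T) ∧ IsKoszulChain S (p + 1) g ∧
      ∀ T, S ⊆ T → koszulD g T + f' T = f T := by
    intro C
    induction C using Finset.induction_on with
    | empty =>
      intro _
      exact ⟨f, 0, hf, hd, fun T _ => Finset.disjoint_empty_left T, fun T h => absurd rfl h,
        fun T _ => by simp⟩
    | insert c C hcC ih =>
      intro hC
      rw [Finset.disjoint_insert_left] at hC
      obtain ⟨f', g, h1, h2, h3, h4, h5⟩ := ih hC.2
      refine ⟨koszulResidue c f', g + koszulContraction c f',
        fun T hT => h1 T (koszulResidue_ne_zero hT).2, fun T hT => ?_, fun T hT => ?_,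
        fun T hT => ?_, fun T hT => ?_⟩
      · rw [koszul_homotopy, map_sub, map_sub, koszulD_koszulD, sub_zero, Pi.sub_apply, h2 T hT,
          zero_sub, neg_eq_zero]
        exact koszulD_eq_zero fun j _ =>
          koszulContraction_eq_zero h2 hC.1 (hT.trans (Finset.subset_insert j T))
      · obtain ⟨h6, h7⟩ := koszulResidue_ne_zero hT
        exact Finset.disjoint_insert_left.2 ⟨h6, h3 T h7⟩
      · by_cases h0 : g T = 0
        · refine h1.contraction c T fun h => hT ?_
          rw [Pi.add_apply, h0, h, add_zero]
        · exact h4 T h0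
      · rw [koszul_homotopy, map_add, ← h5 T hT, Pi.add_apply, Pi.sub_apply, Pi.sub_apply,
          koszulContraction_eq_zero h2 hC.1 hT]
        ring
  obtain ⟨f', g, h1, -, h3, h4, h5⟩ := key Sᶜ disjoint_compl_left
  refine ⟨g, h4, fun T hT => ?_⟩
  rw [← h5 T hT, left_eq_add]
  by_contra h0
  -- With `C = Sᶜ`, a set in the support of `f'` can only be `S` itself, which has fewer than `p`
  -- elements.
  have hTS : T = S := (disjoint_compl_left_iff.1 (h3 T h0)).antisymm hT
  have := (h1 T h0).2
  rw [hTS] at this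
  exact hp.ne this

end Koszul

/-! ### The quotient of the sum of Koszul complexes by the diagonal. -/

section CompleteGraph

variable {k : Type u} [Field k] {V : Type} [LinearOrder V]

variable (V) in
/-- The sets of `p` vertices, pointed at a vertex that is not the largest one. -/
abbrev PointedSet (p : ℕ) : Type :=
  {x : Finset V × V // x.1.card = p ∧ x.2 ∈ x.1 ∧ ∃ b ∈ x.1, x.2 < b}

/-- Extension by zero of a family indexed by `PointedSet`. -/
def pointedExtend (p : ℕ) : (PointedSet V p → MvPolynomial V k) →ₗ[MvPolynomial V k]
    (V → Finset V → MvPolynomial V k) where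
  toFun z a T := if h : T.card = p ∧ a ∈ T ∧ ∃ b ∈ T, a < b then z ⟨(T, a), h⟩ else 0
  map_add' x y := by
    funext a T
    by_cases h : T.card = p ∧ a ∈ T ∧ ∃ b ∈ T, a < b
    · simp only [dif_pos h, Pi.add_apply]
    · simp only [dif_neg h, Pi.add_apply, add_zero]
  map_smul' r x := by
    funext a T
    by_cases h : T.card = p ∧ a ∈ T ∧ ∃ b ∈ T, a < b
    · simp only [dif_pos h, Pi.smul_apply, RingHom.id_apply]
    · simp only [dif_neg h, Pi.smul_apply, RingHom.id_apply, smul_zero]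

lemma pointedSet_nonempty {p : ℕ} (x : PointedSet V p) : x.1.1.Nonempty := ⟨x.1.2, x.2.2.1⟩

/-- The quotient by the diagonal: the value at the largest vertex is subtracted. -/
def pointedQuotient (p : ℕ) : (V → Finset V → MvPolynomial V k) →ₗ[MvPolynomial V k]
    (PointedSet V p → MvPolynomial V k) where
  toFun B x := B x.1.2 x.1.1 - B (x.1.1.max' (pointedSet_nonempty x)) x.1.1
  map_add' B C := by
    funext x
    simp only [Pi.add_apply]
    ring
  map_smul' r B := by
    funext x
    simp only [Pi.smul_apply, RingHom.id_apply, smul_sub]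

lemma pointedQuotient_apply {p : ℕ} (B : V → Finset V → MvPolynomial V k) (x : PointedSet V p) :
    pointedQuotient p B x = B x.1.2 x.1.1 - B (x.1.1.max' (pointedSet_nonempty x)) x.1.1 := rfl

lemma pointedExtend_apply {p : ℕ} (z : PointedSet V p → MvPolynomial V k) (x : PointedSet V p) :
    pointedExtend p z x.1.2 x.1.1 = z x :=
  dif_pos x.2

lemma pointedExtend_eq_zero {p : ℕ} (z : PointedSet V p → MvPolynomial V k) {a : V}
    {T : Finset V} (h : ¬ (T.card = p ∧ a ∈ T ∧ ∃ b ∈ T, a < b)) : pointedExtend p z a T = 0 :=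
  dif_neg h

lemma pointedExtend_max' {p : ℕ} (z : PointedSet V p → MvPolynomial V k) {T : Finset V}
    (hT : T.Nonempty) : pointedExtend p z (T.max' hT) T = 0 := by
  refine pointedExtend_eq_zero z ?_
  rintro ⟨-, -, b, hb, hlt⟩
  exact hlt.not_ge (T.le_max' b hb)

lemma isKoszulChain_pointedExtend {p : ℕ} (z : PointedSet V p → MvPolynomial V k) (a : V) :
    IsKoszulChain {a} p (pointedExtend p z a) := by
  intro T hT
  by_contra h
  refine hT (pointedExtend_eq_zero z fun h' => h ⟨Finset.singleton_subset_iff.2 h'.2.1, h'.1⟩)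

lemma pointedQuotient_pointedExtend {p : ℕ} (z : PointedSet V p → MvPolynomial V k) :
    pointedQuotient p (pointedExtend p z) = z := by
  funext x
  rw [pointedQuotient_apply, pointedExtend_apply, pointedExtend_max', sub_zero]

/-- The diagonal term `β T` cancels against its own value at the maximum of `T`. -/
lemma pointedQuotient_congr {p : ℕ} {A B : V → Finset V → MvPolynomial V k}
    {β : Finset V → MvPolynomial V k} (h : ∀ a, ∀ T, a ∈ T → A a T = B a T - β T) :
    pointedQuotient p A = pointedQuotient p B := by
  funext x
  rw [pointedQuotient_apply, pointedQuotient_apply, h _ _ x.2.2.1, h _ _ (Finset.max'_mem _ _)]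
  ring

open Classical in
/-- The value of a family at the largest vertex of each set. -/
def maxValue (B : V → Finset V → MvPolynomial V k) : Finset V → MvPolynomial V k :=
  fun T => if h : T.Nonempty then B (T.max' h) T else 0

lemma pointedExtend_pointedQuotient {p : ℕ} {B : V → Finset V → MvPolynomial V k}
    (hB : ∀ a, ∀ T, a ∈ T → T.card ≠ p → B a T = 0) {a : V} {T : Finset V} (ha : a ∈ T) :
    pointedExtend p (pointedQuotient p B) a T = B a T - maxValue B T := by
  have hT : T.Nonempty := ⟨a, ha⟩
  rw [maxValue, dif_pos hT]
  by_cases hc : T.card = p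
  · by_cases hm : ∃ b ∈ T, a < b
    · exact pointedExtend_apply (pointedQuotient p B) ⟨(T, a), hc, ha, hm⟩
    · have : a = T.max' hT := (T.le_max' a ha).antisymm (by
        by_contra h
        exact hm ⟨_, T.max'_mem hT, not_le.1 h⟩)
      rw [pointedExtend_eq_zero _ fun h => hm h.2.2, ← this, sub_self]
  · rw [pointedExtend_eq_zero _ fun h => hc h.1, hB a T ha hc, hB _ T (T.max'_mem hT) hc, sub_self]

variable [Fintype V]

/-- The Koszul differential, applied to each member of a family. -/
def pointedD : (V → Finset V → MvPolynomial V k) →ₗ[MvPolynomial V k]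
    (V → Finset V → MvPolynomial V k) :=
  LinearMap.pi fun a => koszulD ∘ₗ LinearMap.proj a

lemma pointedD_apply (A : V → Finset V → MvPolynomial V k) (a : V) :
    pointedD A a = koszulD (A a) := rfl

lemma pointedD_sub {A B : V → Finset V → MvPolynomial V k} {β : Finset V → MvPolynomial V k}
    (h : ∀ a, ∀ T, a ∈ T → A a T = B a T - β T) {a : V} {T : Finset V} (ha : a ∈ T) :
    pointedD A a T = pointedD B a T - koszulD β T := by
  rw [pointedD_apply, pointedD_apply, ← Pi.sub_apply, ← map_sub]
  exact koszulD_congr fun j _ => h a _ (Finset.mem_insert_of_mem ha)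

/-- The exactness of the quotient of the sum over `a` of the Koszul complexes of the variables
other than `x_a` by the diagonal Koszul complex of all variables. -/
lemma pointed_koszul_exact {p : ℕ} (hp : 2 ≤ p) {A : V → Finset V → MvPolynomial V k}
    {β : Finset V → MvPolynomial V k} (hA : ∀ a, IsKoszulChain {a} p (A a))
    (hβ : ∀ a, ∀ T, a ∈ T → pointedD A a T = β T) (hβ0 : β ∅ = 0) (hdβ : koszulD β ∅ = 0) :
    ∃ (B : V → Finset V → MvPolynomial V k) (γ : Finset V → MvPolynomial V k),
      (∀ a, IsKoszulChain {a} (p + 1) (B a)) ∧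
      ∀ a, ∀ T, a ∈ T → pointedD B a T = A a T - γ T := by
  obtain ⟨q, rfl⟩ : ∃ q, p = q + 1 := ⟨p - 1, by omega⟩
  have hβc : IsKoszulChain ∅ q β := by
    intro T hT
    refine ⟨Finset.empty_subset T, ?_⟩
    rcases T.eq_empty_or_nonempty with rfl | ⟨a, ha⟩
    · exact absurd hβ0 hT
    · by_contra hc
      refine hT ?_
      rw [← hβ a T ha, pointedD_apply]
      refine koszulD_eq_zero fun j hj => ?_
      by_contra h0
      have := (hA a _ h0).2
      rw [Finset.card_insert_of_notMem hj] at this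
      exact hc (by omega)
  have hβd : ∀ T, ∅ ⊆ T → koszulD β T = 0 := by
    intro T _
    rcases T.eq_empty_or_nonempty with rfl | ⟨a, ha⟩
    · exact hdβ
    · rw [koszulD_congr (g := koszulD (A a))
        fun j _ => (hβ a _ (Finset.mem_insert_of_mem ha)).symm, koszulD_koszulD, Pi.zero_apply]
  -- The diagonal `β` is a cycle of the full Koszul complex in degree `q ≥ 1`, hence `β = dγ`.
  obtain ⟨γ, hγ, hγd⟩ := koszul_exact (by simp; omega) hβc hβd
  -- Now `A a - γ` is a cycle of the complex for `a`, hence a boundary there. The `if` cuts `γ` down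
  -- to the sets containing `a`.
  have key : ∀ a, ∃ g, IsKoszulChain {a} (q + 1 + 1) g ∧
      ∀ T, {a} ⊆ T → koszulD g T = if a ∈ T then A a T - γ T else 0 := by
    intro a
    refine koszul_exact (by simp; omega) ?_ ?_
    · intro T hT
      dsimp only at hT
      split_ifs at hT with ha
      · refine ⟨Finset.singleton_subset_iff.2 ha, ?_⟩
        by_cases h0 : A a T = 0
        · refine (hγ T fun h => hT ?_).2
          rw [h0, h, sub_zero]
        · exact (hA a T h0).2
      · exact absurd rfl hT
    · intro T hT
      have ha := Finset.singleton_subset_iff.1 hT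
      rw [koszulD_congr (g := A a - γ)
        fun j _ => if_pos (Finset.mem_insert_of_mem ha), map_sub, Pi.sub_apply,
        hγd T (Finset.empty_subset T), ← hβ a T ha, pointedD_apply, sub_self]
  choose B hB hBd using key
  refine ⟨B, γ, hB, fun a T ha => ?_⟩
  rw [pointedD_apply, hBd a T (Finset.singleton_subset_iff.2 ha), if_pos ha]

lemma pointedD_eq_zero_of_card {p : ℕ} {A : V → Finset V → MvPolynomial V k}
    (hA : ∀ a, IsKoszulChain {a} (p + 1) (A a)) (a : V) {T : Finset V} (hT : T.card ≠ p) :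
    pointedD A a T = 0 := by
  refine koszulD_eq_zero fun j hj => ?_
  by_contra h
  have := (hA a _ h).2
  rw [Finset.card_insert_of_notMem hj] at this
  exact hT (by omega)

/-- The differential of the resolution between positive degrees. -/
def pointedSetD (p : ℕ) : (PointedSet V (p + 1) → MvPolynomial V k) →ₗ[MvPolynomial V k]
    (PointedSet V p → MvPolynomial V k) :=
  pointedQuotient p ∘ₗ pointedD ∘ₗ pointedExtend (p + 1)

/-- The differential of the resolution to degree `0`. -/
def pointedSetD₀ : (PointedSet V 2 → MvPolynomial V k) →ₗ[MvPolynomial V k] MvPolynomial V k :=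
  (∑ a, (MvPolynomial.X a : MvPolynomial V k) •
    (LinearMap.proj {a} ∘ₗ LinearMap.proj a :
      (V → Finset V → MvPolynomial V k) →ₗ[MvPolynomial V k] MvPolynomial V k)) ∘ₗ
    pointedD ∘ₗ pointedExtend 2

lemma koszulD_empty (β : Finset V → MvPolynomial V k) :
    koszulD β ∅ = ∑ a, MvPolynomial.X a * β {a} := by
  rw [koszulD_apply]
  simp [koszulSign]

lemma pointedSetD₀_apply (z : PointedSet V 2 → MvPolynomial V k) :
    pointedSetD₀ z = ∑ a, MvPolynomial.X a * pointedD (pointedExtend 2 z) a {a} := by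
  simp [pointedSetD₀]

/-- Extending after passing to the quotient changes a family by the diagonal of its `maxValue`;
applying the differential again kills everything but that diagonal. -/
lemma pointedD_pointedExtend_pointedSetD {p : ℕ} (z : PointedSet V (p + 1) → MvPolynomial V k)
    {a : V} {T : Finset V} (ha : a ∈ T) :
    pointedD (pointedExtend p (pointedSetD p z)) a T =
      - koszulD (maxValue (pointedD (pointedExtend (p + 1) z))) T := by
  have h := pointedD_sub (A := pointedExtend p (pointedSetD p z)) (fun a T ha =>
    pointedExtend_pointedQuotient (B := pointedD (pointedExtend (p + 1) z))
      (fun a T _ hT => pointedD_eq_zero_of_card (isKoszulChain_pointedExtend z) a hT) ha) ha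
  rw [h, pointedD_apply, pointedD_apply, koszulD_koszulD, Pi.zero_apply, zero_sub]

lemma pointedSetD_comp (p : ℕ) (z : PointedSet V (p + 2) → MvPolynomial V k) :
    pointedSetD p (pointedSetD (p + 1) z) = 0 := by
  have h := pointedQuotient_congr (p := p) (B := 0) fun a T ha =>
    (pointedD_pointedExtend_pointedSetD z ha).trans (zero_sub _).symm
  rw [map_zero] at h
  exact h

lemma pointedSetD₀_pointedSetD (z : PointedSet V 3 → MvPolynomial V k) :
    pointedSetD₀ (pointedSetD 2 z) = 0 := by
  have h : koszulD (koszulD (maxValue (pointedD (pointedExtend 3 z)))) ∅ = 0 := by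
    rw [koszulD_koszulD, Pi.zero_apply]
  rw [koszulD_empty] at h
  rw [pointedSetD₀_apply, ← neg_eq_zero, ← h, ← Finset.sum_neg_distrib]
  refine Finset.sum_congr rfl fun a _ => ?_
  rw [pointedD_pointedExtend_pointedSetD z (Finset.mem_singleton_self a), mul_neg, neg_neg]

/-- An element is a cycle of the quotient when the boundary of its extension is a diagonal `β`. The
condition `hdβ` says that the connecting map vanishes on it. -/
lemma exists_pointedSetD_eq {p : ℕ} (hp : 2 ≤ p) (z : PointedSet V p → MvPolynomial V k)
    {β : Finset V → MvPolynomial V k} (hβ : ∀ a, ∀ T, a ∈ T → pointedD (pointedExtend p z) a T = β T)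
    (hβ0 : β ∅ = 0) (hdβ : koszulD β ∅ = 0) : ∃ y, pointedSetD p y = z := by
  obtain ⟨B, γ, hB, hBd⟩ :=
    pointed_koszul_exact hp (isKoszulChain_pointedExtend z) hβ hβ0 hdβ
  refine ⟨pointedQuotient (p + 1) B, ?_⟩
  have h : ∀ a, ∀ T, a ∈ T → pointedD (pointedExtend (p + 1) (pointedQuotient (p + 1) B)) a T =
      pointedExtend p z a T - (γ + koszulD (maxValue B)) T := by
    intro a T ha
    rw [pointedD_sub (fun a T ha => pointedExtend_pointedQuotient (fun a T _ hT => ?_) ha) ha,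
      hBd a T ha, Pi.add_apply]
    · ring
    · by_contra h0
      exact hT (hB a T h0).2
  exact (pointedQuotient_congr h).trans (pointedQuotient_pointedExtend z)

lemma pointedSetD_exact {p : ℕ} (hp : 2 ≤ p) :
    Function.Exact (pointedSetD (k := k) (V := V) (p + 1)) (pointedSetD p) := by
  intro z
  refine ⟨fun hz => ?_, ?_⟩
  · refine exists_pointedSetD_eq (by omega) z
      (β := maxValue (pointedD (pointedExtend (p + 1) z))) (fun a T ha => ?_) ?_ ?_
    · have h := pointedExtend_pointedQuotient (p := p)
        (B := pointedD (pointedExtend (p + 1) z))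
        (fun a T _ hT => pointedD_eq_zero_of_card (isKoszulChain_pointedExtend z) a hT) ha
      have hz' : pointedQuotient p (pointedD (pointedExtend (p + 1) z)) = 0 := hz
      rw [hz', map_zero] at h
      exact (sub_eq_zero.1 h.symm)
    · exact dif_neg Finset.not_nonempty_empty
    · rw [koszulD_empty]
      -- The boundary lives on sets of size `p ≥ 2`, so `β` vanishes on singletons.
      refine Finset.sum_eq_zero fun a _ => ?_
      rw [maxValue, dif_pos (Finset.singleton_nonempty a),
        pointedD_eq_zero_of_card (isKoszulChain_pointedExtend z), mul_zero]
      simp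
      omega
  · rintro ⟨y, rfl⟩
    exact pointedSetD_comp p y

lemma pointedSetD₀_exact :
    Function.Exact (pointedSetD (k := k) (V := V) 2) pointedSetD₀ := by
  intro z
  refine ⟨fun hz => ?_, ?_⟩
  · have hm : ∀ a, maxValue (pointedD (pointedExtend 2 z)) {a} =
        pointedD (pointedExtend 2 z) a {a} := by
      intro a
      rw [maxValue, dif_pos (Finset.singleton_nonempty a), Finset.max'_singleton]
    refine exists_pointedSetD_eq le_rfl z
      (β := maxValue (pointedD (pointedExtend 2 z))) (fun a T ha => ?_) ?_ ?_
    -- On a singleton there is only one choice of `a`, so every family is diagonal in position 1.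
    -- The real condition is `hdβ`, which is `pointedSetD₀ z = 0`.
    · by_cases hT : T.card = 1
      · obtain ⟨b, rfl⟩ := Finset.card_eq_one.1 hT
        rw [Finset.mem_singleton] at ha
        rw [ha, hm]
      · rw [pointedD_eq_zero_of_card (isKoszulChain_pointedExtend z) a hT, maxValue,
          dif_pos ⟨a, ha⟩, pointedD_eq_zero_of_card (isKoszulChain_pointedExtend z) _ hT]
    · exact dif_neg Finset.not_nonempty_empty
    · rw [koszulD_empty, ← hz, pointedSetD₀_apply]
      exact Finset.sum_congr rfl fun a _ => by rw [hm]
  · rintro ⟨y, rfl⟩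
    exact pointedSetD₀_pointedSetD y

end CompleteGraph

section EdgeIdeal

variable {k : Type u} [Field k] {V : Type v}

/-- Membership in an ideal generated by monomials is tested on each monomial of the support. -/
lemma isMultihomogeneous_edgeIdeal (G : SimpleGraph V) : IsMultihomogeneous (edgeIdeal k G) := by
  have h : edgeIdeal k G = Ideal.span ((fun s => MvPolynomial.monomial s (1 : k)) ''
      {s | ∃ u v, G.Adj u v ∧ s = Finsupp.single u 1 + Finsupp.single v 1}) := by
    refine congrArg Ideal.span (Set.ext fun p => ⟨?_, ?_⟩)
    · rintro ⟨u, v, huv, rfl⟩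
      refine ⟨_, ⟨u, v, huv, rfl⟩, ?_⟩
      rw [MvPolynomial.X, MvPolynomial.X, MvPolynomial.monomial_mul, one_mul]
    · rintro ⟨_, ⟨u, v, huv, rfl⟩, rfl⟩
      refine ⟨u, v, huv, ?_⟩
      rw [MvPolynomial.X, MvPolynomial.X, MvPolynomial.monomial_mul, one_mul]
  intro p hp a
  rw [h, MvPolynomial.mem_ideal_span_monomial_image] at hp ⊢
  intro m hm
  refine hp m ?_
  rw [MvPolynomial.mem_support_iff, coeff_shiftedPart] at hm
  rw [MvPolynomial.mem_support_iff]
  split_ifs at hm with h'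
  · exact hm
  · exact absurd rfl hm

end EdgeIdeal

/-! ### Reindexing bases by arbitrary finite types. -/

namespace MultigradedFreeResolution

variable {k : Type u} [Field k] {V : Type v} {I : Ideal (MvPolynomial V k)}

/-- A multigraded free resolution from free modules with arbitrary finite bases. -/
def ofFintype (J : ℕ → Type) [∀ i, Fintype (J i)] (deg : ∀ i, J i → V →₀ ℕ)
    (aug : (J 0 → MvPolynomial V k) →ₗ[MvPolynomial V k] (MvPolynomial V k ⧸ I))
    (d : ∀ i, (J (i + 1) → MvPolynomial V k) →ₗ[MvPolynomial V k] (J i → MvPolynomial V k))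
    (haug : ∀ b, ∀ x ∈ freeComponent k (deg 0) (deg 0 b), ∃ p ∈
      MvPolynomial.restrictSupport k {deg 0 b}, aug x = Ideal.Quotient.mk I p)
    (hd : ∀ i a, ∀ x ∈ freeComponent k (deg (i + 1)) a, d i x ∈ freeComponent k (deg i) a)
    (haug_surj : Function.Surjective aug) (hexact₀ : Function.Exact (d 0) aug)
    (hexact : ∀ i, Function.Exact (d (i + 1)) (d i)) : MultigradedFreeResolution I :=
  let e : ∀ i, Fin (Fintype.card (J i)) ≃ J i := fun i => (Fintype.equivFin (J i)).symm
  let E : ∀ i, (J i → MvPolynomial V k) ≃ₗ[MvPolynomial V k]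
      (Fin (Fintype.card (J i)) → MvPolynomial V k) :=
    fun i => LinearEquiv.funCongrLeft (MvPolynomial V k) (MvPolynomial V k) (e i)
  have hsingle : ∀ i (c : Fin (Fintype.card (J i))),
      (E i).symm (Pi.single c 1) ∈ freeComponent k (deg i) (deg i (e i c)) := by
    intro i c
    refine mem_freeComponent.2 fun b => ?_
    change (Pi.single c 1 : Fin _ → MvPolynomial V k) ((e i).symm b) ∈ _
    by_cases h : (e i).symm b = c
    · rw [h, Pi.single_eq_same]
      refine (MvPolynomial.monomial_mem_restrictSupport k).2 (Or.inl ?_)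
      rw [Set.mem_ofPred_eq, zero_add, ← h, Equiv.apply_symm_apply]
    · rw [Pi.single_eq_of_ne h]
      exact Submodule.zero_mem _
  { rank := fun i => Fintype.card (J i)
    deg := fun i b => deg i (e i b)
    aug := aug ∘ₗ (E 0).symm.toLinearMap
    d := fun i => (E i).toLinearMap ∘ₗ d i ∘ₗ (E (i + 1)).symm.toLinearMap
    aug_homogeneous := fun b => haug _ _ (hsingle 0 b)
    d_homogeneous := fun i c => mem_freeComponent.2 fun b =>
      mem_freeComponent.1 (hd i _ _ (hsingle (i + 1) c)) (e i b)
    aug_surjective := haug_surj.comp (E 0).symm.surjective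
    exact_zero := by
      intro x
      rw [LinearMap.comp_apply, hexact₀]
      constructor
      · rintro ⟨y, hy⟩
        exact ⟨E 1 y, by simp [hy]⟩
      · rintro ⟨y, rfl⟩
        exact ⟨(E 1).symm y, by simp⟩
    exact_succ := by
      intro i x
      rw [LinearMap.comp_apply, LinearMap.comp_apply, LinearEquiv.coe_coe,
        LinearEquiv.map_eq_zero_iff, hexact]
      constructor
      · rintro ⟨y, hy⟩
        exact ⟨E (i + 2) y, by simp [hy]⟩
      · rintro ⟨y, rfl⟩
        exact ⟨(E (i + 2)).symm y, by simp⟩ }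

end MultigradedFreeResolution

/-! ### The minimal resolution for the complete graph: degrees, minimality, ranks. -/

section CompleteGraph

variable {k : Type u} [Field k] {V : Type}

/-- The multidegree of the product of a set of variables. -/
def squarefreeDegree (T : Finset V) : V →₀ ℕ := ∑ j ∈ T, Finsupp.single j 1

lemma degree_squarefreeDegree (T : Finset V) : (squarefreeDegree T).degree = T.card := by
  simp [squarefreeDegree, map_sum]

lemma X_mul_mem_restrictSupport {S S' : Set (V →₀ ℕ)} {j : V}
    (h : ∀ m ∈ S, Finsupp.single j 1 + m ∈ S') {p : MvPolynomial V k}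
    (hp : p ∈ MvPolynomial.restrictSupport k S) :
    MvPolynomial.X j * p ∈ MvPolynomial.restrictSupport k S' := by
  rw [MvPolynomial.mem_restrictSupport_iff, MvPolynomial.support_X_mul]
  intro m hm
  obtain ⟨m', hm', rfl⟩ := Finset.mem_map.1 (Finset.mem_coe.1 hm)
  exact h m' ((MvPolynomial.mem_restrictSupport_iff k).1 hp hm')

variable [LinearOrder V]

lemma squarefreeDegree_insert {j : V} {T : Finset V} (hj : j ∉ T) :
    squarefreeDegree (insert j T) = Finsupp.single j 1 + squarefreeDegree T :=
  Finset.sum_insert hj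

lemma pointedExtend_mem {p : ℕ} {α : V →₀ ℕ} {z : PointedSet V p → MvPolynomial V k}
    (hz : z ∈ freeComponent k (fun x => squarefreeDegree x.1.1) α) (a : V) :
    pointedExtend p z a ∈ freeComponent k squarefreeDegree α := by
  refine mem_freeComponent.2 fun T => ?_
  by_cases h : T.card = p ∧ a ∈ T ∧ ∃ b ∈ T, a < b
  · rw [pointedExtend_apply z ⟨(T, a), h⟩]
    exact mem_freeComponent.1 hz ⟨(T, a), h⟩
  · rw [pointedExtend_eq_zero z h]
    exact Submodule.zero_mem _

lemma pointedQuotient_mem {p : ℕ} {α : V →₀ ℕ} {B : V → Finset V → MvPolynomial V k}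
    (hB : ∀ a, B a ∈ freeComponent k squarefreeDegree α) :
    pointedQuotient p B ∈ freeComponent k (fun x => squarefreeDegree x.1.1) α :=
  mem_freeComponent.2 fun _ =>
    Submodule.sub_mem _ (mem_freeComponent.1 (hB _) _) (mem_freeComponent.1 (hB _) _)

variable [Fintype V]

lemma koszulD_mem {α : V →₀ ℕ} {f : Finset V → MvPolynomial V k}
    (hf : f ∈ freeComponent k squarefreeDegree α) :
    koszulD f ∈ freeComponent k squarefreeDegree α := by
  refine mem_freeComponent.2 fun T => ?_
  rw [koszulD_apply]
  refine Submodule.sum_mem _ fun j hj => zsmul_mem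
    (X_mul_mem_restrictSupport (fun m hm => ?_) (mem_freeComponent.1 hf (insert j T))) _
  rw [Set.mem_ofPred_eq, squarefreeDegree_insert (Finset.mem_compl.1 hj)] at hm
  rw [Set.mem_ofPred_eq, ← hm]
  abel

lemma pointedSetD_mem {p : ℕ} {α : V →₀ ℕ} {z : PointedSet V (p + 1) → MvPolynomial V k}
    (hz : z ∈ freeComponent k (fun x => squarefreeDegree x.1.1) α) :
    pointedSetD p z ∈ freeComponent k (fun x => squarefreeDegree x.1.1) α :=
  pointedQuotient_mem fun a => koszulD_mem (pointedExtend_mem hz a)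

lemma pointedSetD₀_mem {α : V →₀ ℕ} {z : PointedSet V 2 → MvPolynomial V k}
    (hz : z ∈ freeComponent k (fun x => squarefreeDegree x.1.1) α) :
    pointedSetD₀ z ∈ MvPolynomial.restrictSupport k {m | m + 0 = α} := by
  rw [pointedSetD₀_apply]
  refine Submodule.sum_mem _ fun a _ => X_mul_mem_restrictSupport (fun m hm => ?_)
    (mem_freeComponent.1 (koszulD_mem (pointedExtend_mem hz a)) {a})
  rw [Set.mem_ofPred_eq, squarefreeDegree, Finset.sum_singleton] at hm
  rw [Set.mem_ofPred_eq, ← hm, add_zero, add_comm]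

lemma constantCoeff_koszulD (f : Finset V → MvPolynomial V k) (T : Finset V) :
    MvPolynomial.constantCoeff (koszulD f T) = 0 := by
  rw [koszulD_apply, map_sum]
  refine Finset.sum_eq_zero fun j _ => ?_
  rw [map_zsmul, map_mul, MvPolynomial.constantCoeff_X, zero_mul, smul_zero]

lemma constantCoeff_pointedSetD {p : ℕ} (z : PointedSet V (p + 1) → MvPolynomial V k)
    (x : PointedSet V p) : MvPolynomial.constantCoeff (pointedSetD p z x) = 0 := by
  rw [pointedSetD, LinearMap.comp_apply, LinearMap.comp_apply, pointedQuotient_apply,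
    pointedD_apply, pointedD_apply, map_sub, constantCoeff_koszulD, constantCoeff_koszulD,
    sub_zero]

lemma constantCoeff_pointedSetD₀ (z : PointedSet V 2 → MvPolynomial V k) :
    MvPolynomial.constantCoeff (pointedSetD₀ z) = 0 := by
  rw [pointedSetD₀_apply, map_sum]
  refine Finset.sum_eq_zero fun a _ => ?_
  rw [map_mul, MvPolynomial.constantCoeff_X, zero_mul]

/-- Every term of the image carries a factor `x_a x_j` with `j ≠ a`; conversely, for `a < b`, the
basis vector at `({a, b}, a)` maps to `-x_a x_b`. -/
lemma range_pointedSetD₀ : LinearMap.range (pointedSetD₀ (k := k) (V := V)) =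
    edgeIdeal k (SimpleGraph.completeGraph V) := by
  refine le_antisymm ?_ (Submodule.span_le.2 ?_)
  · rintro _ ⟨z, rfl⟩
    rw [pointedSetD₀_apply]
    refine Ideal.sum_mem _ fun a _ => ?_
    rw [pointedD_apply, koszulD_apply, Finset.mul_sum]
    refine Ideal.sum_mem _ fun j hj => ?_
    rw [mul_smul_comm, ← mul_assoc]
    rw [Finset.mem_compl, Finset.mem_singleton] at hj
    have hmem : MvPolynomial.X a * MvPolynomial.X j ∈
        edgeIdeal k (SimpleGraph.completeGraph V) :=
      Ideal.subset_span ⟨a, j, Ne.symm hj, rfl⟩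
    exact zsmul_mem (Ideal.mul_mem_right _ _ hmem) _
  · have key : ∀ a b : V, a < b →
        MvPolynomial.X a * MvPolynomial.X b ∈ LinearMap.range (pointedSetD₀ (k := k)) := by
      intro a b hab
      let x : PointedSet V 2 := ⟨({a, b}, a), Finset.card_pair hab.ne, by simp, b, by simp, hab⟩
      -- The minus sign compensates `koszulSign b {a} = -1`, as `a < b`.
      refine ⟨- Pi.single x 1, ?_⟩
      have hext : ∀ c j, j ≠ c → pointedExtend 2 (Pi.single x (1 : MvPolynomial V k)) c {j, c} =
          if c = a ∧ j = b then 1 else 0 := by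
        intro c j hjc
        split_ifs with h
        · obtain ⟨rfl, rfl⟩ := h
          rw [Finset.pair_comm]
          exact (pointedExtend_apply _ x).trans (Pi.single_eq_same _ _)
        · by_cases h' : ({j, c} : Finset V).card = 2 ∧ c ∈ ({j, c} : Finset V) ∧
              ∃ b ∈ ({j, c} : Finset V), c < b
          · refine (pointedExtend_apply _ (⟨(_, c), h'⟩ : PointedSet V 2)).trans
              (Pi.single_eq_of_ne ?_ _)
            intro heq
            have h1 := congrArg (fun y => y.1.1) heq
            have h2 := congrArg (fun y => y.1.2) heq
            simp only [x] at h1 h2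
            have hj : j ∈ ({a, b} : Finset V) := by rw [← h1]; simp
            simp only [Finset.mem_insert, Finset.mem_singleton] at hj
            subst h2
            exact h ⟨rfl, hj.resolve_left hjc⟩
          · exact pointedExtend_eq_zero _ h'
      have hD : ∀ c, pointedD (pointedExtend 2 (Pi.single x (1 : MvPolynomial V k))) c {c} =
          if c = a then - MvPolynomial.X b else 0 := by
        intro c
        rw [pointedD_apply, koszulD_apply]
        split_ifs with h
        · subst h
          rw [Finset.sum_eq_single_of_mem b (by simpa using hab.ne'), hext _ _ hab.ne']
          · have : koszulSign b {c} = -1 := by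
              simp [koszulSign, Finset.filter_singleton, hab]
            rw [this, if_pos ⟨rfl, rfl⟩, mul_one, neg_smul, one_smul]
          · intro j hj hjb
            rw [hext _ _ (by simpa using hj), if_neg fun h => hjb h.2, mul_zero, smul_zero]
        · refine Finset.sum_eq_zero fun j hj => ?_
          rw [hext _ _ (by simpa using hj), if_neg fun h' => h h'.1, mul_zero, smul_zero]
      rw [map_neg, pointedSetD₀_apply, Finset.sum_eq_single_of_mem a (Finset.mem_univ a), hD,
        if_pos rfl, mul_neg, neg_neg]
      intro c _ hca
      rw [hD, if_neg hca, mul_zero]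
    rintro _ ⟨a, b, hab, rfl⟩
    rcases lt_or_gt_of_ne (hab : a ≠ b) with h | h
    · exact key a b h
    · rw [mul_comm]
      exact key b a h

variable (V) in
/-- The index types of the bases of the resolution of the complete graph. -/
abbrev CompleteIndex : ℕ → Type
  | 0 => Unit
  | i + 1 => PointedSet V (i + 2)

instance fintypeCompleteIndex : ∀ i, Fintype (CompleteIndex V i)
  | 0 => inferInstanceAs (Fintype Unit)
  | i + 1 => inferInstanceAs (Fintype (PointedSet V (i + 2)))

/-- The multidegrees of the bases of the resolution of the complete graph. -/
def completeDegree : ∀ i, CompleteIndex V i → V →₀ ℕ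
  | 0 => fun _ => 0
  | _ + 1 => fun x => squarefreeDegree x.1.1

variable (k V) in
/-- The differentials of the resolution of the complete graph. -/
def completeD : ∀ i, (CompleteIndex V (i + 1) → MvPolynomial V k) →ₗ[MvPolynomial V k]
    (CompleteIndex V i → MvPolynomial V k)
  | 0 => LinearMap.pi fun _ => pointedSetD₀
  | i + 1 => pointedSetD (i + 2)

variable (k V) in
/-- The minimal multigraded free resolution of the graph ideal of a complete graph. -/
def completeResolution :
    MultigradedFreeResolution (edgeIdeal k (SimpleGraph.completeGraph V)) :=
  MultigradedFreeResolution.ofFintype (CompleteIndex V) completeDegree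
    ((Ideal.Quotient.mkₐ (MvPolynomial V k) _).toLinearMap ∘ₗ LinearMap.proj ()) (completeD k V)
    (by
      intro b x hx
      refine ⟨x (), ?_, rfl⟩
      have := mem_freeComponent.1 hx ()
      simpa [completeDegree] using this)
    (by
      rintro (_ | i) a x hx
      · exact mem_freeComponent.2 fun _ => pointedSetD₀_mem hx
      · exact pointedSetD_mem hx)
    (by
      intro y
      obtain ⟨p, rfl⟩ := Ideal.Quotient.mk_surjective y
      exact ⟨fun _ => p, rfl⟩)
    (by
      intro x
      change Ideal.Quotient.mk _ (x ()) = 0 ↔ _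
      rw [Ideal.Quotient.eq_zero_iff_mem, ← range_pointedSetD₀]
      constructor
      · rintro ⟨z, hz⟩
        exact ⟨z, funext fun _ => hz⟩
      · rintro ⟨z, rfl⟩
        exact ⟨z, rfl⟩)
    (by
      rintro (_ | i)
      · intro z
        refine Iff.trans ?_ (pointedSetD₀_exact z)
        exact ⟨fun h => congrFun h (), fun h => funext fun _ => h⟩
      · exact pointedSetD_exact (by omega))

lemma isMinimal_completeResolution : (completeResolution k V).IsMinimal := by
  have key : ∀ i z b, MvPolynomial.constantCoeff (completeD k V i z b) = 0 := by
    rintro (_ | i) z b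
    · exact constantCoeff_pointedSetD₀ z
    · exact constantCoeff_pointedSetD z b
  exact fun i c b => key i _ _

lemma degree_deg_completeResolution_zero (b : Fin ((completeResolution k V).rank 0)) :
    ((completeResolution k V).deg 0 b).degree = 0 :=
  map_zero _

lemma degree_deg_completeResolution_succ (i : ℕ) (b : Fin ((completeResolution k V).rank (i + 1))) :
    ((completeResolution k V).deg (i + 1) b).degree = i + 2 := by
  let x : PointedSet V (i + 2) := (Fintype.equivFin (CompleteIndex V (i + 1))).symm b
  exact (degree_squarefreeDegree x.1.1).trans x.2.1

/-- Each set of `p + 1` vertices has `p` elements other than its maximum. -/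
lemma card_pointedSet (p : ℕ) :
    Fintype.card (PointedSet V (p + 1)) = p * (Fintype.card V).choose (p + 1) := by
  let e : PointedSet V (p + 1) ≃
      Σ T : {T : Finset V // T.card = p + 1}, {a // a ∈ T.1 ∧ ∃ b ∈ T.1, a < b} :=
    { toFun := fun x => ⟨⟨x.1.1, x.2.1⟩, x.1.2, x.2.2⟩
      invFun := fun y => ⟨(y.1.1, y.2.1), y.1.2, y.2.2⟩
      left_inv := fun _ => rfl
      right_inv := fun _ => rfl }
  have hfib : ∀ T : {T : Finset V // T.card = p + 1},
      Fintype.card {a // a ∈ T.1 ∧ ∃ b ∈ T.1, a < b} = p := by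
    rintro ⟨T, hT⟩
    have hne : T.Nonempty := Finset.card_pos.1 (by omega)
    rw [Fintype.card_of_subtype (T.erase (T.max' hne)), Finset.card_erase_of_mem (T.max'_mem hne),
      hT, Nat.add_sub_cancel]
    intro a
    rw [Finset.mem_erase, and_comm]
    refine and_congr_right fun ha => ⟨fun h => ⟨_, T.max'_mem hne,
      lt_of_le_of_ne (T.le_max' a ha) h⟩, ?_⟩
    rintro ⟨b, hb, hab⟩ rfl
    exact hab.not_ge (T.le_max' b hb)
  rw [Fintype.card_congr e, Fintype.card_sigma, Finset.sum_congr rfl fun T _ => hfib T,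
    Finset.sum_const, Finset.card_univ, Fintype.card_finset_len, smul_eq_mul, mul_comm]

lemma rank_completeResolution_zero : (completeResolution k V).rank 0 = 1 :=
  Fintype.card_unit

lemma rank_completeResolution_succ (i : ℕ) :
    (completeResolution k V).rank (i + 1) = (i + 1) * (Fintype.card V).choose (i + 2) :=
  card_pointedSet (i + 1)

end CompleteGraph

/-- The sum counts the basis of `F i` by the fibres of `deg i`; since all total degrees equal `e`,
it sees the whole basis or nothing. -/
lemma MultigradedFreeResolution.IsMinimal.sum_finrank_torComponent {k : Type u} [Field k]
    {V : Type v} [Fintype V] [DecidableEq V] {I : Ideal (MvPolynomial V k)}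
    {F : MultigradedFreeResolution I} (hF : F.IsMinimal) {i e : ℕ}
    (he : ∀ b, (F.deg i b).degree = e) (d : ℕ) :
    ∑ a ∈ Finset.finsuppAntidiag (Finset.univ : Finset V) d,
      Module.finrank k (F.torComponent i a) = if d = e then F.rank i else 0 := by
  have hmem : ∀ a : V →₀ ℕ, a ∈ Finset.finsuppAntidiag (Finset.univ : Finset V) d ↔
      a.degree = d := by
    intro a
    rw [Finset.mem_finsuppAntidiag, Finsupp.degree_eq_sum]
    exact and_iff_left (Finset.subset_univ _)
  split_ifs with h
  · simp only [hF.finrank_torComponent]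
    rw [← Finset.card_eq_sum_card_fiberwise fun b _ => (hmem _).2 ((he b).trans h.symm),
      Finset.card_univ, Fintype.card_fin]
  · refine Finset.sum_eq_zero fun a ha => ?_
    rw [hF.finrank_torComponent, Finset.card_eq_zero, Finset.filter_eq_empty_iff]
    rintro b - rfl
    exact h (((hmem _).1 ha).symm.trans (he b))

lemma gradedBetti_eq {k : Type u} [Field k] {V : Type v} [Fintype V] [DecidableEq V]
    {G : SimpleGraph V} {F : MultigradedFreeResolution (edgeIdeal k G)} (hF : F.IsMinimal)
    {i e : ℕ} (he : ∀ b, (F.deg i b).degree = e) (d : ℕ) :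
    gradedBetti k G i d = if d = e then F.rank i else 0 := by
  rw [gradedBetti, ← hF.sum_finrank_torComponent he]
  exact Finset.sum_congr rfl fun a _ =>
    multigradedBetti_eq (isMultihomogeneous_edgeIdeal G) F i a

end GraphBetti
end

theorem mainTheorem11 (k : Type*) [Field k] (n : ℕ) :
    (∀ i d : ℕ, 1 ≤ i →
      GraphBetti.gradedBetti k (SimpleGraph.completeGraph (Fin n)) i d =
        if d = i + 1 then i * n.choose (i + 1) else 0) ∧
    (∀ i : ℕ, 1 ≤ i →
      GraphBetti.totalBetti k (SimpleGraph.completeGraph (Fin n)) i = i * n.choose (i + 1)) ∧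
    (∀ d : ℕ, GraphBetti.gradedBetti k (SimpleGraph.completeGraph (Fin n)) 0 d = if d = 0 then 1 else 0) ∧
    GraphBetti.totalBetti k (SimpleGraph.completeGraph (Fin n)) 0 = 1 := by
  have hmin := GraphBetti.isMinimal_completeResolution (k := k) (V := Fin n)
  have hrank : ∀ i, (GraphBetti.completeResolution k (Fin n)).rank (i + 1) =
      (i + 1) * n.choose (i + 2) := fun i => by
    rw [GraphBetti.rank_completeResolution_succ, Fintype.card_fin]
  refine ⟨?_, ?_, ?_, ?_⟩
  · rintro (_ | i) d hi
    · omega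
    · rw [GraphBetti.gradedBetti_eq hmin (GraphBetti.degree_deg_completeResolution_succ i), hrank]
  · rintro (_ | i) hi
    · omega
    · exact (hmin.finrank_tor' (i + 1)).trans (hrank i)
  · intro d
    rw [GraphBetti.gradedBetti_eq hmin GraphBetti.degree_deg_completeResolution_zero,
      GraphBetti.rank_completeResolution_zero]
  · exact (hmin.finrank_tor' 0).trans GraphBetti.rank_completeResolution_zero
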